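/- **Definitions.** Let $V$ be a finite set with $d$ elements. A *$k$-th order $t$-cherry junction tree* is a tree of clusters (subsets of $V$) built recursively: start with one cluster of size $k$; repeatedly choose a cluster $L$, a set $S\subset L$ with $|S|=k-1$ and a vertex $x$ in no cluster so far, add the cluster $S\cup\{x\}$ and link it to $L$. It is *on $V$* if its clusters cover $V$. The *separators* are the intersections of linked clusters; $\nu_S$ is the number of clusters containing $S$. A vertex is *simplicial* if it lies in exactly one cluster, and a cluster containing a simplicial vertex is a *leaf cluster*. *Algorithm 1*, one pass from $T_{m+1}$ to $T_m$: (1) the separators of $T_{m+1}$ become clusters of $T_m$, and two different ones are linked if they are separators on links at a common cluster of $T_{m+1}$; (2) from every leaf cluster $K$ of $T_{m+1}$ an arbitrary non-simplicial vertex is deleted, and the resulting cluster is added to $T_m$ and linked to the separator at $K$. The tree $T_1$ is the graph on $V$ whose edges are the clusters (of size 2) of $T_2$. *A regular vine structure up to level $q$* is a sequence $T_1,\dots,T_q$ in which $T_1$ is a tree on $V$, the clusters of $T_2$ are the edges of $T_1$, each $T_m$ ($2\le m\le q$) is an $m$-th order $t$-cherry junction tree on $V$, and each cluster of $T_{m+1}$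 is the union of two linked clusters of $T_m$. It is complete if $q=d-1$. Truncation at level $k$ means that all pair-copula densities on $T_k,\dots,T_{d-1}$ are set to $1$. Let $X=(X_i)_{i\in V}$ be a random vector whose law is absolutely continuous with respect to Lebesgue measure on $\mathbb R^V$, $F_i$ the distribution function of $X_i$, $u_i=F_i(x_i)$, $f_K$ the density and $c_K$ the copula density of $X_K$. Let $F_{i|S}(\cdot\mid x_S)$ be the conditional distribution function of $X_i$ given $X_S=x_S$, and $c_{a,b|S}$ the copula density of the conditional law of $(X_a,X_b)$ given $X_S=x_S$ (it may depend on $x_S$, and is taken jointly measurable). For a link between clusters $A$ and $B$ put $S=A\cap B$, $\{a\}=A\setminus S$, $\{b\}=B\setminus S$. **Theorem.** Let $k\ge 2$, let $T_k$ be a $k$-th order $t$-cherry junction tree on $V$ with set of clusters $\mathcal C$ and set of separators $\mathcal S$, and let $T_{k-1},\dots,T_2$ be obtained from it by recursive application of Algorithm 1, with any choices of the deleted vertices, where for every $1\le m<k$ the separators of $T_{m+1}$ are the clusters of an $m$-th order $t$-cherry junction tree. Then: (i) $k<d$, and $T_1,\dots,T_k$ is a regular vine structure up to level $k$. (ii)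 For almost every $u\in[0,1]^V$ (that is, for almost every $x$ with respect to the product of the laws of the $X_i$), $$\frac{\prod_{K\in\mathcal C}c_K(u_K)}{\prod_{S\in\mathcal S}c_S(u_S)^{\nu_S-1}}=\prod_{\{l,m\}\in T_1}c_{l,m}\big(F_l(x_l),F_m(x_m)\big)\cdot\prod_{i=2}^{k-1}\ \prod_{\text{links of }T_i}c_{a,b|S}\big(F_{a|S}(x_a|x_S),F_{b|S}(x_b|x_S)\big),$$ with the convention $0/0=0$. (iii) The structure extends to a complete regular vine structure, and the left-hand side of (ii) equals the copula density of this vine truncated at level $k$, for almost every $u$. (iv) If the law of $X$ is itself the $t$-cherry distribution of $T_k$, i.e. $f_V=\prod_{K\in\mathcal C} f_K/\prod_{S\in\mathcal S} f_S^{\nu_S-1}$ almost everywhere (with $0/0=0$), then the copula density $c_V$ of $X$ equals the right-hand side of (ii) for almost every $u$. -/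

import Mathlib

open MeasureTheory ProbabilityTheory
open scoped ENNReal symmDiff

/-! ### Cluster trees and `t`-cherry junction trees -/

/-- A family of clusters (subsets of the vertex set `V`), some pairs of which are linked. -/
@[ext]
structure ClusterTree (V : Type*) where
  /-- the clusters -/
  clusters : Finset (Finset V)
  /-- the links between clusters -/
  linked : SimpleGraph (Finset V)
  /-- only clusters are linked -/
  mem_of_linked : ∀ A B, linked.Adj A B → A ∈ clusters

namespace ClusterTree

variable {V : Type*}

/-- The tree consisting of the single cluster `K`. -/
def single (K : Finset V) : ClusterTree V where
  clusters := {K}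
  linked := ⊥
  mem_of_linked := by simp

variable [DecidableEq V]

/-- Add the cluster `K` to the tree `T` and link it to the cluster `L` of `T`. -/
def attach (T : ClusterTree V) (L K : Finset V) (hL : L ∈ T.clusters) : ClusterTree V where
  clusters := insert K T.clusters
  linked := T.linked ⊔ SimpleGraph.edge L K
  mem_of_linked := by
    intro A B h
    rw [SimpleGraph.sup_adj, SimpleGraph.edge_adj] at h
    rcases h with h | ⟨⟨rfl, rfl⟩ | ⟨rfl, rfl⟩, _⟩
    · exact Finset.mem_insert_of_mem (T.mem_of_linked A B h)
    · exact Finset.mem_insert_of_mem hL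
    · exact Finset.mem_insert_self _ _

/-- `k`-th order `t`-cherry junction trees.  A new vertex `x` is joined to the `k - 1` vertices of a
complete subgraph `S` of the graph built so far (such a subgraph is contained in a cluster `L`); the
new hypercherry gives the cluster `S ∪ {x}`, which is linked to `L` by the separator `S`. -/
inductive IsTCherry (k : ℕ) : ClusterTree V → Prop
  | single (K : Finset V) (hK : K.card = k) : IsTCherry k (ClusterTree.single K)
  | extend (T : ClusterTree V) (hT : IsTCherry k T) (L S : Finset V) (x : V)
      (hL : L ∈ T.clusters) (hS : S ⊆ L) (hcard : S.card + 1 = k)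
      (hx : ∀ K ∈ T.clusters, x ∉ K) : IsTCherry k (T.attach L (insert x S) hL)

/-- The clusters cover the whole vertex set. -/
def Covers (T : ClusterTree V) : Prop := ∀ v : V, ∃ K ∈ T.clusters, v ∈ K

/-- `S` is the separator on one of the links at the cluster `K`. -/
def SeparatorAt (T : ClusterTree V) (S K : Finset V) : Prop :=
  ∃ L, T.linked.Adj K L ∧ S = K ∩ L

/-- A vertex is simplicial if it lies in exactly one cluster. -/
def IsSimplicial (T : ClusterTree V) (v : V) : Prop := ∃! K, K ∈ T.clusters ∧ v ∈ K

open Classical in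
/-- The leaf clusters: those which contain a simplicial vertex. -/
noncomputable def leafClusters (T : ClusterTree V) : Finset (Finset V) :=
  T.clusters.filter fun K => ∃ v ∈ K, T.IsSimplicial v

/-- `ν_S`, the number of clusters which contain `S`. -/
def nu (T : ClusterTree V) (S : Finset V) : ℕ := (T.clusters.filter fun K => S ⊆ K).card

variable [Fintype V]

open Classical in
/-- The set of separators, i.e. of intersections of two linked clusters. -/
noncomputable def separators (T : ClusterTree V) : Finset (Finset V) :=
  Finset.univ.filter fun S => ∃ K, T.SeparatorAt S K

open Classical in
/-- The set of links, as unordered pairs of clusters. -/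
noncomputable def links (T : ClusterTree V) : Finset (Sym2 (Finset V)) := T.linked.edgeFinset

/-- The separators of `T` are the clusters of a `t`-cherry junction tree of order `m`. -/
def SeparatorsFormTCherry (m : ℕ) (T : ClusterTree V) : Prop :=
  ∃ U : ClusterTree V, U.clusters = T.separators ∧ IsTCherry m U

/-- Steps 1 and 2 of the algorithm, where `y K` is the vertex deleted from the leaf cluster `K`.
Step 1: the separators of `T` become clusters; two different ones are linked if there is one cluster
of `T` between them.  Step 2: each leaf cluster `K` becomes the cluster `K \ {y K}`, linked to the
separator at `K`. -/
noncomputable def reduce (T : ClusterTree V) (y : Finset V → V) : ClusterTree V where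
  clusters := T.separators ∪ T.leafClusters.image fun K => K.erase (y K)
  linked := SimpleGraph.fromRel fun A B =>
    (∃ K, T.SeparatorAt A K ∧ T.SeparatorAt B K) ∨
      ∃ K ∈ T.leafClusters, A = K.erase (y K) ∧ T.SeparatorAt B K
  mem_of_linked := by
    intro A B h
    have key : ∀ S K, T.SeparatorAt S K → S ∈ T.separators := fun S K hS => by
      simpa [separators] using ⟨K, hS⟩
    rw [SimpleGraph.fromRel_adj] at h
    rcases h.2 with (⟨K, hA, -⟩ | ⟨K, hK, rfl, -⟩) | (⟨K, -, hA⟩ | ⟨K, -, -, hA⟩)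
    · exact Finset.mem_union_left _ (key _ _ hA)
    · exact Finset.mem_union_right _ (Finset.mem_image_of_mem (fun K => K.erase (y K)) hK)
    · exact Finset.mem_union_left _ (key _ _ hA)
    · exact Finset.mem_union_left _ (key _ _ hA)

/-- `T'` is a possible result of one pass of the algorithm on `T`: the vertex deleted from each leaf
cluster is an arbitrary vertex of it which is not simplicial. -/
def AlgorithmStep (T T' : ClusterTree V) : Prop :=
  ∃ y : Finset V → V,
    (∀ K ∈ T.leafClusters, y K ∈ K ∧ ¬ T.IsSimplicial (y K)) ∧ T' = T.reduce y

/-- The first tree of the vine: the graph on `V` whose edges are the clusters of `T₂`. -/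
def firstTree (T₂ : ClusterTree V) : SimpleGraph V :=
  SimpleGraph.fromRel fun a b => ({a, b} : Finset V) ∈ T₂.clusters

end ClusterTree

/-- `T₁, T 2, …, T q` are the first `q` trees of a regular vine structure on `V`: `T₁` is a tree on
`V`, the clusters of `T 2` are the edges of `T₁`, each `T m` is an `m`-th order `t`-cherry junction
tree on `V`, and each cluster of `T (m + 1)` is the union of two linked clusters of `T m`.
The structure is complete for `q = |V| - 1`. -/
structure IsRVineStructure {V : Type*} [DecidableEq V] (T₁ : SimpleGraph V)
    (T : ℕ → ClusterTree V) (q : ℕ) : Prop where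
  isTree : T₁.IsTree
  edges : 2 ≤ q → ∀ K, K ∈ (T 2).clusters ↔ ∃ a b, T₁.Adj a b ∧ K = {a, b}
  isTCherry : ∀ m, 2 ≤ m → m ≤ q → (T m).IsTCherry m
  covers : ∀ m, 2 ≤ m → m ≤ q → (T m).Covers
  union : ∀ m, 2 ≤ m → m < q → ∀ K ∈ (T (m + 1)).clusters,
    ∃ A B, (T m).linked.Adj A B ∧ K = A ∪ B

/-! ### Copulas and copula densities -/

section Copula

variable {ι α : Type*} [MeasurableSpace α]

/-- The distribution function of the `i`-th coordinate. -/
noncomputable def marginalCdf (Q : Measure (ι → ℝ)) (i : ι) (t : ℝ) : ℝ :=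
  cdf (Q.map fun x => x i) t

/-- The copula of a distribution `Q` with continuous marginals, as a probability measure on the unit
cube: the law of `(F_i (X_i))_i`.  Its distribution function is the copula function of `Q`. -/
noncomputable def copula (Q : Measure (ι → ℝ)) : Measure (ι → ℝ) :=
  Q.map fun x i => marginalCdf Q i (x i)

theorem measurable_marginalCdf_kernel (κ : Kernel α (ι → ℝ)) [IsMarkovKernel κ] (i : ι) :
    Measurable fun p : α × ℝ => marginalCdf (κ p.1) i p.2 := by
  have h : (fun p : α × ℝ => marginalCdf (κ p.1) i p.2)
      = fun p : α × ℝ => (κ p.1 (Prod.mk p ⁻¹' {r : (α × ℝ) × (ι → ℝ) | r.2 i ≤ r.1.2})).toReal := by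
    funext p
    have hm : Measurable fun x : ι → ℝ => x i := measurable_pi_apply i
    have : IsProbabilityMeasure ((κ p.1).map fun x => x i) :=
      Measure.isProbabilityMeasure_map hm.aemeasurable
    rw [marginalCdf, cdf_eq_real, measureReal_def, Measure.map_apply hm measurableSet_Iic]
    rfl
  rw [h]
  have hs : MeasurableSet {r : (α × ℝ) × (ι → ℝ) | r.2 i ≤ r.1.2} :=
    measurableSet_le ((measurable_pi_apply i).comp measurable_snd)
      (measurable_snd.comp measurable_fst)
  exact (Kernel.measurable_kernel_prodMk_left (κ := κ.comap Prod.fst measurable_fst) hs).ennreal_toReal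

/-- The copulas of the members of a family of probability distributions. -/
noncomputable def copulaKernel (κ : Kernel α (ι → ℝ)) [IsMarkovKernel κ] : Kernel α (ι → ℝ) where
  toFun a := copula (κ a)
  measurable' := by
    have hg : Measurable fun p : α × (ι → ℝ) => fun i : ι => marginalCdf (κ p.1) i (p.2 i) :=
      measurable_pi_lambda _ fun i => (measurable_marginalCdf_kernel κ i).comp
        (measurable_fst.prodMk ((measurable_pi_apply i).comp measurable_snd))
    refine Measure.measurable_of_measurable_coe _ fun s hs => ?_
    have h : (fun a => copula (κ a) s) = fun a => κ a (Prod.mk a ⁻¹'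
        ((fun p : α × (ι → ℝ) => fun i : ι => marginalCdf (κ p.1) i (p.2 i)) ⁻¹' s)) := by
      funext a
      have ha : Measurable fun x : ι → ℝ => fun i : ι => marginalCdf (κ a) i (x i) :=
        hg.comp measurable_prodMk_left
      rw [copula, Measure.map_apply ha hs]
      rfl
    rw [h]
    exact Kernel.measurable_kernel_prodMk_left (hg hs)

variable [Fintype ι]

/-- Lebesgue measure on the unit cube `[0,1]^ι`. -/
noncomputable def cubeVolume (ι : Type*) [Fintype ι] : Measure (ι → ℝ) :=
  volume.restrict (Set.Icc 0 1)

instance : IsFiniteMeasure (cubeVolume ι) :=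
  ⟨by rw [cubeVolume, Measure.restrict_apply_univ]; exact isCompact_Icc.measure_lt_top⟩

/-- The copula density of `Q`. -/
noncomputable def copulaDensity (Q : Measure (ι → ℝ)) : (ι → ℝ) → ℝ≥0∞ :=
  (copula Q).rnDeriv (cubeVolume ι)

end Copula

section Densities

variable {V : Type*} [Fintype V]

/-- The marginal density `f_K`, at `x_K`. -/
noncomputable def marginalDensity (P : Measure (V → ℝ)) (K : Finset V) (x : V → ℝ) : ℝ≥0∞ :=
  (P.map K.restrict).rnDeriv volume (K.restrict x)

/-- `c_K(u_K)`, where `c_K` is the copula density of `X_K` and `u_i = F_i(x_i)`. -/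
noncomputable def clusterCopula (P : Measure (V → ℝ)) (K : Finset V) (x : V → ℝ) : ℝ≥0∞ :=
  copulaDensity (P.map K.restrict) fun i : K => marginalCdf P i (x i)

/-- The conditional distribution function `F_{i|S}(t | x_S)`. -/
noncomputable def condDistribFun (P : Measure (V → ℝ)) [IsProbabilityMeasure P] (i : V)
    (S : Finset V) (s : S → ℝ) (t : ℝ) : ℝ :=
  cdf (condDistrib (fun x : V → ℝ => x i) S.restrict P s) t

/-- The conditional copula density `c_{D|S}( · | x_S)`: the density of the copula of the conditional
distribution of `X_D` given `X_S = x_S`, chosen jointly measurable in `x_S` and its argument. -/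
noncomputable def condCopulaDensity (P : Measure (V → ℝ)) [IsProbabilityMeasure P]
    (D S : Finset V) (s : S → ℝ) : (D → ℝ) → ℝ≥0∞ :=
  Kernel.rnDeriv (copulaKernel (condDistrib (D.restrict (π := fun _ => ℝ)) S.restrict P))
    (Kernel.const _ (cubeVolume D)) s

/-- `c_{D|S}(F_{i|S}(x_i | x_S), i ∈ D)`. -/
noncomputable def condCopula (P : Measure (V → ℝ)) [IsProbabilityMeasure P]
    (D S : Finset V) (x : V → ℝ) : ℝ≥0∞ :=
  condCopulaDensity P D S (S.restrict x) fun i : D => condDistribFun P i S (S.restrict x) (x i)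

variable [DecidableEq V]

/-- The pair copula density `c_{a,b|S}(F_{a|S}(x_a|x_S), F_{b|S}(x_b|x_S))` of a link between the
clusters `A` and `B`, where `S = A ∩ B`, `{a} = A \ S` and `{b} = B \ S`; thus `{a, b} = A ∆ B`. -/
noncomputable def linkCopula (P : Measure (V → ℝ)) [IsProbabilityMeasure P] (x : V → ℝ) :
    Sym2 (Finset V) → ℝ≥0∞ :=
  Sym2.lift ⟨fun A B => condCopula P (A ∆ B) (A ∩ B) x, fun A B => by
    show condCopula P (A ∆ B) (A ∩ B) x = condCopula P (B ∆ A) (B ∩ A) x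
    rw [symmDiff_comm, Finset.inter_comm]⟩

/-- The product of the pair copula densities `c_{l,m}(F_l(x_l), F_m(x_m))` on the edges of the first
tree. -/
noncomputable def firstTreeProduct (P : Measure (V → ℝ)) (T₁ : SimpleGraph V) (x : V → ℝ) : ℝ≥0∞ :=
  open Classical in ∏ e ∈ T₁.edgeFinset, clusterCopula P e.toFinset x

/-- The `t`-cherry copula density (product of the cluster copula densities over the product of the
powers `ν_S - 1` of the separator copula densities) at `u_i = F_i(x_i)`. -/
noncomputable def tCherryCopula (P : Measure (V → ℝ)) (T : ClusterTree V) (x : V → ℝ) : ℝ≥0∞ :=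
  (∏ K ∈ T.clusters, clusterCopula P K x) /
    ∏ S ∈ T.separators, clusterCopula P S x ^ (T.nu S - 1)

/-- `P` is itself the `t`-cherry junction tree probability distribution of `T`. -/
def IsTCherryDistribution (P : Measure (V → ℝ)) (T : ClusterTree V) : Prop :=
  ∀ᵐ x ∂(volume : Measure (V → ℝ)), marginalDensity P Finset.univ x =
    (∏ K ∈ T.clusters, marginalDensity P K x) /
      ∏ S ∈ T.separators, marginalDensity P S x ^ (T.nu S - 1)

/-- The copula density of the regular vine `T₁, T 2, …, T (|V| - 1)` truncated at level `k`: the pair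
copulas on the trees `T m` with `m ≥ k` are set to the independence copula, of density `1`. -/
noncomputable def truncatedRVineCopula (P : Measure (V → ℝ)) [IsProbabilityMeasure P]
    (T₁ : SimpleGraph V) (T : ℕ → ClusterTree V) (k : ℕ) (x : V → ℝ) : ℝ≥0∞ :=
  firstTreeProduct P T₁ x * ∏ m ∈ Finset.Icc 2 (Fintype.card V - 1),
    ∏ e ∈ (T m).links, if m < k then linkCopula P x e else 1

end Densities

/-!
The proof has a combinatorial and a probabilistic half.

**The algorithm produces a regular vine.**  A cluster tree is recognized as a `t`-cherry junction
tree by counting (`ClusterTree.isTCherry_of_card`): if it is connected, if linked clusters differ in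
at most one vertex, and if it has as many vertices and as few links as such a tree, then each cluster
added along a link brings exactly one new vertex.  For one pass of the algorithm these counts come
from two facts.  The separators cover the non-simplicial vertices only, while each leaf cluster has
a simplicial vertex of its own, which bounds the number of new clusters.  And the ends of a new link
arise from a common old cluster, which is their union, and at most two new clusters arise from an
old one, because the separators form a `t`-cherry junction tree; this bounds the number of new links,
and equality of the counts also makes each old cluster the union of a new link (`ClusterTree.isTCherry_reduce`,
`ClusterTree.exists_union_of_reduce`).  A vine structure is extended upwards by turning the links
into clusters in the order in which they were added (`IsRVineStructure.exists_complete`).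

**The copula density telescopes.**  Let `g K` be the density of `X_K` relative to the product of the
marginals; by Sklar's theorem for densities (`copulaDensity_mul_prod_rnDeriv`) it is `c_K(u_K)`
almost everywhere.  The same theorem applied to the conditional distribution given `X_S`, and the
chain rule for densities (`rnDeriv_prodMk_eq_mul`), give for a link between `A` and `B` with pair
copula density `c` the identity `c * g A * g B = g (A ∪ B) * g (A ∩ B)`
(`condCopula_mul_clusterDensity`).  The unions `A ∪ B` over the links of `T_m` are the clusters of
`T_{m+1}`, and the number of links of `T_m` at a cluster `A` is one more than the number of links of
`T_{m+1}` with separator `A`.  Multiplying over all links, the quotient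
`∏ clusters g / ∏ separators g` of `T_{m+1}` is thus that of `T_m` times the pair copula densities on
`T_m` (`ClusterTree.IsTCherry.prod_div_succ`), and for `T_2` it is the product over the edges of
`T_1`, since the separators are single vertices.  Where the density of a cluster vanishes, so do
those of all larger sets, and both sides are zero.

If `X` has the `t`-cherry distribution, Sklar's theorem for all clusters and separators cancels the
marginal densities and leaves its copula density (`clusterCopula_univ_eq_tCherryCopula`).
-/

/-! ### Combinatorics of `t`-cherry junction trees -/

/-- The intersection of the two clusters of a link. -/
def linkSep {V : Type*} [DecidableEq V] : Sym2 (Finset V) → Finset V :=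
  Sym2.lift ⟨fun A B => A ∩ B, fun A B => Finset.inter_comm A B⟩

/-- The union of the two clusters of a link. -/
def linkUnion {V : Type*} [DecidableEq V] : Sym2 (Finset V) → Finset V :=
  Sym2.lift ⟨fun A B => A ∪ B, fun A B => Finset.union_comm A B⟩

namespace ClusterTree

variable {V : Type*} {k m : ℕ} {T : ClusterTree V}

@[simp] lemma single_clusters (K : Finset V) : (single K).clusters = {K} := rfl

lemma not_single_adj (K A B : Finset V) : ¬ (single K).linked.Adj A B := fun h => h

lemma right_mem_of_linked {A B : Finset V} (h : T.linked.Adj A B) : B ∈ T.clusters :=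
  T.mem_of_linked B A h.symm

lemma exists_linked_crossing {𝒜 : Finset (Finset V)} {A B : Finset V} (hA : A ∈ 𝒜) (hB : B ∉ 𝒜)
    (h : T.linked.Reachable A B) : ∃ C D, C ∈ 𝒜 ∧ D ∉ 𝒜 ∧ T.linked.Adj C D := by
  obtain ⟨p⟩ := h
  obtain ⟨d, -, hd, hd'⟩ := p.exists_boundary_dart (𝒜 : Set (Finset V)) hA hB
  exact ⟨d.fst, d.snd, hd, hd', d.adj⟩

lemma mem_links [Fintype V] {e : Sym2 (Finset V)} : e ∈ T.links ↔ e ∈ T.linked.edgeSet := by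
  simp [links]

@[simp] lemma mk_mem_links [Fintype V] {A B : Finset V} : s(A, B) ∈ T.links ↔ T.linked.Adj A B := by
  simp [mem_links]

lemma link_notMem [Fintype V] {L K : Finset V} (hK : K ∉ T.clusters) : s(L, K) ∉ T.links := fun h =>
  hK (right_mem_of_linked (mk_mem_links.1 h))

lemma links_single [Fintype V] (K : Finset V) : (single K).links = ∅ := by
  ext e
  induction e with | _ A B => simp [single]

lemma mem_leafClusters {K : Finset V} :
    K ∈ T.leafClusters ↔ K ∈ T.clusters ∧ ∃ v ∈ K, T.IsSimplicial v := by
  unfold leafClusters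
  classical
  rw [Finset.mem_filter]

variable [DecidableEq V]

@[simp] lemma linkSep_mk (A B : Finset V) : linkSep s(A, B) = A ∩ B := rfl
@[simp] lemma linkUnion_mk (A B : Finset V) : linkUnion s(A, B) = A ∪ B := rfl

lemma attach_adj {L K : Finset V} (hL : L ∈ T.clusters) {A B : Finset V} :
    (T.attach L K hL).linked.Adj A B ↔
      T.linked.Adj A B ∨ ((A = L ∧ B = K ∨ A = K ∧ B = L) ∧ A ≠ B) := by
  simp [attach, SimpleGraph.sup_adj, SimpleGraph.edge_adj, eq_comm]

@[simp] lemma attach_clusters {L K : Finset V} (hL : L ∈ T.clusters) :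
    (T.attach L K hL).clusters = insert K T.clusters := rfl

lemma insert_notMem_clusters {x : V} (hx : ∀ K ∈ T.clusters, x ∉ K) (S : Finset V) :
    insert x S ∉ T.clusters := fun h => hx _ h (Finset.mem_insert_self _ _)

lemma inter_insert_of_fresh {x : V} {L S : Finset V} (hx : x ∉ L) (hS : S ⊆ L) :
    L ∩ insert x S = S := by
  rw [Finset.inter_insert_of_notMem hx, Finset.inter_eq_right.2 hS]

lemma IsTCherry.card_eq (h : T.IsTCherry k) {K : Finset V} (hK : K ∈ T.clusters) : K.card = k := by
  induction h generalizing K with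
  | single K' hK' => rw [single_clusters, Finset.mem_singleton] at hK; rw [hK, hK']
  | extend T hT L S x hL hS hcard hx ih =>
    rw [attach_clusters, Finset.mem_insert] at hK
    rcases hK with rfl | hK
    · rw [Finset.card_insert_of_notMem fun h => hx L hL (hS h), hcard]
    · exact ih hK

lemma IsTCherry.clusters_nonempty (h : T.IsTCherry k) : T.clusters.Nonempty := by
  cases h with
  | single K hK => exact ⟨K, Finset.mem_singleton_self K⟩
  | extend T hT L S x hL hS hcard hx => exact ⟨_, Finset.mem_insert_self _ _⟩

lemma IsTCherry.card_inter (h : T.IsTCherry k) {A B : Finset V} (hAB : T.linked.Adj A B) :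
    (A ∩ B).card + 1 = k := by
  induction h generalizing A B with
  | single K' hK' => exact absurd hAB (not_single_adj _ _ _)
  | extend T hT L S x hL hS hcard hx ih =>
    rw [attach_adj] at hAB
    rcases hAB with h | ⟨⟨rfl, rfl⟩ | ⟨rfl, rfl⟩, -⟩
    · exact ih h
    · rw [inter_insert_of_fresh (hx _ hL) hS, hcard]
    · rw [Finset.inter_comm, inter_insert_of_fresh (hx _ hL) hS, hcard]

/-- Each cluster after the first one contributes exactly one new vertex. -/
lemma IsTCherry.card_sup (h : T.IsTCherry k) :
    (T.clusters.sup id).card + 1 = k + T.clusters.card := by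
  induction h with
  | single K hK => simp [hK]
  | extend T hT L S x hL hS hcard hx ih =>
    have hSU : S ⊆ T.clusters.sup id := hS.trans (Finset.le_sup (f := id) hL)
    have hxU : x ∉ T.clusters.sup id := by
      rw [Finset.mem_sup]; rintro ⟨K, hK, h⟩; exact hx K hK h
    rw [attach_clusters, Finset.sup_insert, Finset.card_insert_of_notMem
      (insert_notMem_clusters hx S), id, Finset.sup_eq_union, Finset.insert_union,
      Finset.union_eq_right.2 hSU, Finset.card_insert_of_notMem hxU]
    omega

lemma IsTCherry.reachable (h : T.IsTCherry k) {A B : Finset V} (hA : A ∈ T.clusters)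
    (hB : B ∈ T.clusters) : T.linked.Reachable A B := by
  induction h generalizing A B with
  | single K hK =>
    rw [single_clusters, Finset.mem_singleton] at hA hB
    rw [hA, hB]
  | extend T hT L S x hL hS hcard hx ih =>
    have hmono : T.linked ≤ (T.attach L (insert x S) hL).linked := le_sup_left
    have key : ∀ C ∈ (T.attach L (insert x S) hL).clusters,
        (T.attach L (insert x S) hL).linked.Reachable L C := by
      intro C hC
      rw [attach_clusters, Finset.mem_insert] at hC
      rcases hC with rfl | hC
      · refine SimpleGraph.Adj.reachable ?_
        rw [attach_adj]
        exact Or.inr ⟨Or.inl ⟨rfl, rfl⟩, fun h =>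
          hx L hL (h ▸ Finset.mem_insert_self x S)⟩
      · exact (ih hL hC).mono hmono
    exact (key A hA).symm.trans (key B hB)

/-- A cluster inside the union of two linked clusters is one of the two. -/
lemma IsTCherry.eq_or_eq_of_subset_union (h : T.IsTCherry k) {A B C : Finset V}
    (hAB : T.linked.Adj A B) (hC : C ∈ T.clusters) (hsub : C ⊆ A ∪ B) : C = A ∨ C = B := by
  induction h generalizing A B C with
  | single K' hK' => exact absurd hAB (not_single_adj _ _ _)
  | extend T hT L S x hL hS hcard hx ih =>
    have hxL := hx L hL
    rw [attach_clusters, Finset.mem_insert] at hC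
    have key : ∀ C ∈ T.clusters, C ⊆ L ∪ insert x S → C = L := by
      intro C hC hsub
      refine Finset.eq_of_subset_of_card_le (fun v hv => ?_)
        (by rw [hT.card_eq hC, hT.card_eq hL])
      have hvx : v ≠ x := by intro h; exact hx C hC (h ▸ hv)
      have := hsub hv
      simp only [Finset.mem_union, Finset.mem_insert, hvx, false_or] at this
      exact this.elim id fun h => hS h
    rw [attach_adj] at hAB
    rcases hAB with h | ⟨⟨rfl, rfl⟩ | ⟨rfl, rfl⟩, -⟩
    · rcases hC with rfl | hC
      · have := hsub (Finset.mem_insert_self x S)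
        rw [Finset.mem_union] at this
        rcases this with h' | h'
        · exact absurd h' (hx _ (T.mem_of_linked _ _ h))
        · exact absurd h' (hx _ (right_mem_of_linked h))
      · exact ih h hC hsub
    · rcases hC with rfl | hC
      · exact Or.inr rfl
      · exact Or.inl (key C hC hsub)
    · rcases hC with rfl | hC
      · exact Or.inl rfl
      · exact Or.inr (key C hC (by rwa [Finset.union_comm]))

/-- The proximity condition of regular vines: what two links have in common lies in one cluster. -/
lemma IsTCherry.exists_inter_subset (h : T.IsTCherry k) {A B A' B' : Finset V}
    (hAB : T.linked.Adj A B) (hAB' : T.linked.Adj A' B') (hne : A ∪ B ≠ A' ∪ B') :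
    ∃ C ∈ T.clusters, (A ∪ B) ∩ (A' ∪ B') ⊆ C := by
  induction h generalizing A B A' B' with
  | single K' hK' => exact absurd hAB (not_single_adj _ _ _)
  | extend T hT L S x hL hS hcard hx ih =>
    have hU : L ∪ insert x S = insert x L := by
      rw [Finset.union_insert, Finset.union_eq_left.2 hS]
    have hx' : ∀ {A B : Finset V}, T.linked.Adj A B → x ∉ A ∪ B := fun h => by
      rw [Finset.mem_union, not_or]
      exact ⟨hx _ (T.mem_of_linked _ _ h), hx _ (right_mem_of_linked h)⟩
    have hcase : ∀ {A B : Finset V}, (T.attach L (insert x S) hL).linked.Adj A B →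
        T.linked.Adj A B ∨ A ∪ B = insert x L := by
      intro A B h
      rw [attach_adj] at h
      rcases h with h | ⟨⟨rfl, rfl⟩ | ⟨rfl, rfl⟩, -⟩
      · exact Or.inl h
      · exact Or.inr hU
      · exact Or.inr (by rw [Finset.union_comm, hU])
    rcases hcase hAB with h | h <;> rcases hcase hAB' with h' | h'
    · obtain ⟨C, hC, hsub⟩ := ih h h' hne
      exact ⟨C, Finset.mem_insert_of_mem hC, hsub⟩
    · refine ⟨L, Finset.mem_insert_of_mem hL, ?_⟩
      rw [h', Finset.inter_insert_of_notMem (hx' h)]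
      exact Finset.inter_subset_right
    · refine ⟨L, Finset.mem_insert_of_mem hL, ?_⟩
      rw [h, Finset.insert_inter_of_notMem (hx' h')]
      exact Finset.inter_subset_left
    · exact absurd (h.trans h'.symm) hne

/-- A set of `k + 1` vertices contains at most two clusters: three would form a clique which is too
large. -/
lemma IsTCherry.eq_or_eq_of_subset_card (h : T.IsTCherry k) {K A B C : Finset V}
    (hK : K.card = k + 1) (hA : A ∈ T.clusters) (hB : B ∈ T.clusters) (hC : C ∈ T.clusters)
    (hAK : A ⊆ K) (hBK : B ⊆ K) (hCK : C ⊆ K) : A = B ∨ A = C ∨ B = C := by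
  induction h generalizing A B C with
  | single K' hK' =>
    rw [single_clusters, Finset.mem_singleton] at hA hB
    exact Or.inl (hA.trans hB.symm)
  | extend T hT L S x hL hS hcard hx ih =>
    -- when the new cluster is in `K`, so is `x`, and an old cluster in `K` has to be `K \ {x}`
    have key : ∀ C ∈ T.clusters, C ⊆ K → x ∈ K → C = K.erase x := by
      intro C hC hCK hxK
      refine Finset.eq_of_subset_of_card_le (fun v hv => Finset.mem_erase.2 ⟨?_, hCK hv⟩) ?_
      · intro h; exact hx C hC (h ▸ hv)
      · rw [Finset.card_erase_of_mem hxK, hK, hT.card_eq hC]; rfl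
    rw [attach_clusters, Finset.mem_insert] at hA hB hC
    rcases hA with rfl | hA <;> rcases hB with rfl | hB
    · exact Or.inl rfl
    · rcases hC with rfl | hC
      · exact Or.inr (Or.inl rfl)
      · have hxK := hAK (Finset.mem_insert_self x S)
        exact Or.inr (Or.inr ((key B hB hBK hxK).trans (key C hC hCK hxK).symm))
    · rcases hC with rfl | hC
      · exact Or.inr (Or.inr rfl)
      · have hxK := hBK (Finset.mem_insert_self x S)
        exact Or.inr (Or.inl ((key A hA hAK hxK).trans (key C hC hCK hxK).symm))
    · rcases hC with rfl | hC
      · have hxK := hCK (Finset.mem_insert_self x S)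
        exact Or.inl ((key A hA hAK hxK).trans (key B hB hBK hxK).symm)
      · exact ih hA hB hC hAK hBK hCK

lemma IsTCherry.exists_linked (h : T.IsTCherry k) (h2 : 2 ≤ T.clusters.card) {A : Finset V}
    (hA : A ∈ T.clusters) : ∃ B, T.linked.Adj A B := by
  obtain ⟨B, hB, hne⟩ := Finset.exists_mem_ne h2 A
  obtain ⟨C, D, hC, -, hCD⟩ := exists_linked_crossing (𝒜 := {A}) (Finset.mem_singleton_self A)
    (by simpa using hne) (h.reachable hA hB)
  rw [Finset.mem_singleton] at hC
  exact ⟨D, hC ▸ hCD⟩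

section Fintype

variable [Fintype V]

lemma links_attach {L K : Finset V} (hL : L ∈ T.clusters) (hK : K ∉ T.clusters) :
    (T.attach L K hL).links = insert s(L, K) T.links := by
  have hne : L ≠ K := by rintro rfl; exact hK hL
  ext e
  induction e with | _ A B =>
  rw [mk_mem_links, attach_adj, Finset.mem_insert, mk_mem_links, Sym2.eq_iff]
  constructor
  · rintro (h | ⟨h, -⟩)
    · exact Or.inr h
    · exact Or.inl h
  · rintro (h | h)
    · refine Or.inr ⟨h, ?_⟩
      rcases h with ⟨rfl, rfl⟩ | ⟨rfl, rfl⟩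
      · exact hne
      · exact hne.symm
    · exact Or.inl h

lemma mem_separators {S : Finset V} : S ∈ T.separators ↔ ∃ e ∈ T.links, linkSep e = S := by
  unfold separators
  classical
  rw [Finset.mem_filter]
  constructor
  · rintro ⟨-, K, L, h, rfl⟩; exact ⟨s(K, L), mk_mem_links.2 h, rfl⟩
  · rintro ⟨e, he, rfl⟩
    induction e with | _ A B => exact ⟨Finset.mem_univ _, A, B, mk_mem_links.1 he, rfl⟩

lemma IsTCherry.card_linkSep (h : T.IsTCherry k) {e : Sym2 (Finset V)} (he : e ∈ T.links) :
    (linkSep e).card + 1 = k := by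
  induction e with | _ A B => exact h.card_inter (mk_mem_links.1 he)

lemma IsTCherry.card_links (h : T.IsTCherry k) : T.links.card + 1 = T.clusters.card := by
  induction h with
  | single K hK => rw [links_single, single_clusters]; simp
  | extend T hT L S x hL hS hcard hx ih =>
    have hK := insert_notMem_clusters hx S
    rw [links_attach hL hK, attach_clusters, Finset.card_insert_of_notMem hK,
      Finset.card_insert_of_notMem (link_notMem hK), ih]

/-- The running intersection property in numerical form: the clusters which contain `R` form a
subtree, so there is one more of them than there are links whose separator contains `R`. -/
lemma IsTCherry.card_filter_subset (h : T.IsTCherry k) {R : Finset V}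
    (hR : ∃ C ∈ T.clusters, R ⊆ C) :
    (T.clusters.filter (R ⊆ ·)).card = (T.links.filter (R ⊆ linkSep ·)).card + 1 := by
  induction h with
  | single K hK =>
    obtain ⟨C, hC, hRC⟩ := hR
    rw [single_clusters, Finset.mem_singleton] at hC
    subst hC
    rw [links_single]
    simp [Finset.filter_singleton, hRC]
  | extend T hT L S x hL hS hcard hx ih =>
    have hK := insert_notMem_clusters hx S
    rw [links_attach hL hK, attach_clusters, Finset.filter_insert, Finset.filter_insert,
      linkSep_mk, inter_insert_of_fresh (hx _ hL) hS]
    by_cases hxR : x ∈ R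
    · -- no old cluster and no separator contains `x`
      have hRK : R ⊆ insert x S := by
        obtain ⟨C, hC, hRC⟩ := hR
        rw [attach_clusters, Finset.mem_insert] at hC
        rcases hC with rfl | hC
        · exact hRC
        · exact absurd (hRC hxR) (hx C hC)
      have h0 : T.clusters.filter (R ⊆ ·) = ∅ :=
        Finset.filter_eq_empty_iff.2 fun C hC h => hx C hC (h hxR)
      have h1 : T.links.filter (R ⊆ linkSep ·) = ∅ := by
        refine Finset.filter_eq_empty_iff.2 fun e he h => ?_
        induction e with | _ A B =>
        exact hx A (T.mem_of_linked A B (mk_mem_links.1 he))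
          (Finset.mem_of_mem_inter_left (h hxR))
      rw [if_pos hRK, if_neg fun h => hx L hL (hS (h hxR)), h0, h1]
      simp
    · have hiff : R ⊆ insert x S ↔ R ⊆ S := Finset.subset_insert_iff_of_notMem hxR
      have hR' : ∃ C ∈ T.clusters, R ⊆ C := by
        obtain ⟨C, hC, hRC⟩ := hR
        rw [attach_clusters, Finset.mem_insert] at hC
        rcases hC with rfl | hC
        · exact ⟨L, hL, (hiff.1 hRC).trans hS⟩
        · exact ⟨C, hC, hRC⟩
      by_cases hRS : R ⊆ S
      · rw [if_pos (hiff.2 hRS), if_pos hRS, Finset.card_insert_of_notMem, ih hR',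
          Finset.card_insert_of_notMem]
        · exact fun h => link_notMem hK (Finset.mem_of_mem_filter _ h)
        · exact fun h => hK (Finset.mem_of_mem_filter _ h)
      · rw [if_neg (mt hiff.1 hRS), if_neg hRS, ih hR']

/-- The number of links with a given separator `S` is `ν_S - 1`. -/
lemma IsTCherry.card_filter_linkSep_eq (h : T.IsTCherry k) {S : Finset V} (hS : S.card + 1 = k)
    (hC : ∃ C ∈ T.clusters, S ⊆ C) :
    (T.links.filter (linkSep · = S)).card + 1 = T.nu S := by
  rw [nu, h.card_filter_subset hC]
  congr 2
  refine Finset.filter_congr fun e he => ⟨fun h => h ▸ subset_rfl, fun hsub => ?_⟩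
  exact (Finset.eq_of_subset_of_card_le hsub (by have := h.card_linkSep he; omega)).symm

/-- The separators, counted with multiplicity `ν_S - 1`, are the separators on the links. -/
lemma IsTCherry.prod_separators {M : Type*} [CommMonoid M] (h : T.IsTCherry k)
    (g : Finset V → M) :
    ∏ S ∈ T.separators, g S ^ (T.nu S - 1) = ∏ e ∈ T.links, g (linkSep e) := by
  rw [← Finset.prod_fiberwise_of_maps_to (t := T.separators) (g := linkSep)
    (fun e he => mem_separators.2 ⟨e, he, rfl⟩)]
  refine Finset.prod_congr rfl fun S hS => ?_
  obtain ⟨e, he, rfl⟩ := mem_separators.1 hS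
  have hC : ∃ C ∈ T.clusters, linkSep e ⊆ C := by
    clear hS
    induction e with | _ A B =>
    exact ⟨A, T.mem_of_linked A B (mk_mem_links.1 he), Finset.inter_subset_left⟩
  rw [← h.card_filter_linkSep_eq (h.card_linkSep he) hC, Nat.add_sub_cancel,
    Finset.prod_congr rfl fun e' he' => congrArg g (Finset.mem_filter.1 he').2, Finset.prod_const]

/-- By the running intersection property, a vertex lies in one more cluster than separators. -/
lemma IsTCherry.prod_vertices {M : Type*} [CommMonoid M] (h : T.IsTCherry k) (g : V → M) :
    ∏ K ∈ T.clusters, ∏ i ∈ K, g i =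
      (∏ e ∈ T.links, ∏ i ∈ linkSep e, g i) * ∏ i ∈ T.clusters.sup id, g i := by
  induction h with
  | single K hK => rw [links_single, single_clusters]; simp
  | extend T hT L S x hL hS hcard hx ih =>
    have hK := insert_notMem_clusters hx S
    have hSU : S ⊆ T.clusters.sup id := hS.trans (Finset.le_sup (f := id) hL)
    have hxU : x ∉ T.clusters.sup id := by
      rw [Finset.mem_sup]; rintro ⟨K, hK, h⟩; exact hx K hK h
    rw [links_attach hL hK, attach_clusters, Finset.prod_insert hK,
      Finset.prod_insert (link_notMem hK), linkSep_mk, inter_insert_of_fresh (hx _ hL) hS,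
      Finset.sup_insert, id, Finset.sup_eq_union, Finset.insert_union,
      Finset.union_eq_right.2 hSU, Finset.prod_insert hxU,
      Finset.prod_insert fun h => hx L hL (hS h), ih]
    ac_rfl

end Fintype

end ClusterTree

namespace ClusterTree

variable {V : Type*} [DecidableEq V] {k m : ℕ} {T : ClusterTree V}

/-! ### Recognizing `t`-cherry junction trees by counting -/

/-- In a connected cluster tree whose links add at most one vertex, `𝒜` and the `n` remaining
clusters have at most `n` vertices more than `𝒜`. -/
lemma card_sup_le_of_connected (hadj : ∀ A B, T.linked.Adj A B → (B \ A).card ≤ 1)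
    (hconn : ∀ A ∈ T.clusters, ∀ B ∈ T.clusters, T.linked.Reachable A B) (n : ℕ)
    (𝒜 : Finset (Finset V)) (hne : 𝒜.Nonempty) (hsub : 𝒜 ⊆ T.clusters)
    (hn : T.clusters.card = 𝒜.card + n) :
    (T.clusters.sup id).card ≤ (𝒜.sup id).card + n := by
  induction n generalizing 𝒜 with
  | zero => rw [Finset.eq_of_subset_of_card_le hsub hn.le]; rfl
  | succ n ih =>
    obtain ⟨A, hA⟩ := hne
    obtain ⟨B, hB, hB'⟩ := Finset.exists_mem_notMem_of_card_lt_card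
      (show 𝒜.card < T.clusters.card by omega)
    obtain ⟨C, D, hC, hD, hCD⟩ := exists_linked_crossing hA hB' (hconn A (hsub hA) B hB)
    have h1 := ih (insert D 𝒜) (Finset.insert_nonempty _ _)
      (Finset.insert_subset (right_mem_of_linked hCD) hsub)
      (by rw [Finset.card_insert_of_notMem hD]; omega)
    have h2 : ((insert D 𝒜).sup id).card ≤ (𝒜.sup id).card + 1 := by
      rw [Finset.sup_insert, id, Finset.sup_eq_union, Finset.union_comm,
        ← Finset.union_sdiff_self_eq_union]
      refine (Finset.card_union_le _ _).trans (Nat.add_le_add_left ?_ _)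
      refine (Finset.card_le_card ?_).trans (hadj C D hCD)
      exact Finset.sdiff_subset_sdiff subset_rfl (Finset.le_sup (f := id) hC)
    omega

/-- A connected cluster tree with clusters of size `k`, links which differ in one vertex, as many
vertices as possible and as few links as possible is a `k`-th order `t`-cherry junction tree. -/
theorem isTCherry_of_card [Fintype V] (hne : T.clusters.Nonempty)
    (hcard : ∀ A ∈ T.clusters, A.card = k)
    (hadj : ∀ A B, T.linked.Adj A B → (B \ A).card ≤ 1)
    (hconn : ∀ A ∈ T.clusters, ∀ B ∈ T.clusters, T.linked.Reachable A B)
    (hsup : k + T.clusters.card ≤ (T.clusters.sup id).card + 1)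
    (hlinks : T.links.card + 1 ≤ T.clusters.card) : T.IsTCherry k := by
  have grow : ∀ j, 1 ≤ j → j ≤ T.clusters.card → ∃ W : ClusterTree V, W.IsTCherry k ∧
      W.clusters ⊆ T.clusters ∧ W.linked ≤ T.linked ∧ W.clusters.card = j := by
    intro j hj
    induction j, hj using Nat.le_induction with
    | base =>
      intro _
      obtain ⟨K, hK⟩ := hne
      exact ⟨single K, .single K (hcard K hK), by simpa using hK,
        fun A B h => absurd h (not_single_adj K A B), by simp⟩
    | succ j hj ih =>
      intro hjT
      obtain ⟨W, hW, hWT, hWl, hWj⟩ := ih (by omega)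
      obtain ⟨A, hA⟩ := hW.clusters_nonempty
      obtain ⟨B, hB, hB'⟩ := Finset.exists_mem_notMem_of_card_lt_card
        (show W.clusters.card < T.clusters.card by omega)
      obtain ⟨C, D, hC, hD, hCD⟩ := exists_linked_crossing hA hB' (hconn A (hWT hA) B hB)
      have hDT := right_mem_of_linked hCD
      -- otherwise `D` adds no vertex, and in the end there are too few of them
      have hnew : ¬ D ⊆ W.clusters.sup id := by
        intro hsub
        have h1 := card_sup_le_of_connected hadj hconn (T.clusters.card - (j + 1))
          (insert D W.clusters) (Finset.insert_nonempty _ _) (Finset.insert_subset hDT hWT)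
          (by rw [Finset.card_insert_of_notMem hD]; omega)
        rw [Finset.sup_insert, id, Finset.sup_eq_union, Finset.union_eq_right.2 hsub] at h1
        have h2 := hW.card_sup
        omega
      obtain ⟨x, hxD, hx⟩ := Finset.not_subset.1 hnew
      have hx' : ∀ K ∈ W.clusters, x ∉ K := fun K hK h =>
        hx (Finset.le_sup (f := id) hK h)
      have hxC := hx' C hC
      have hDx : D \ C = {x} := by
        refine (Finset.eq_of_subset_of_card_le ?_ ?_).symm
        · simpa using ⟨hxD, hxC⟩
        · simpa using hadj C D hCD
      have hD' : insert x (D.erase x) = D := Finset.insert_erase hxD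
      have hSC : D.erase x ⊆ C := by
        intro v hv
        rw [Finset.mem_erase] at hv
        by_contra hvC
        exact hv.1 (Finset.mem_singleton.1 (hDx ▸ Finset.mem_sdiff.2 ⟨hv.2, hvC⟩))
      refine ⟨W.attach C (insert x (D.erase x)) hC, .extend W hW C _ x hC hSC ?_ hx', ?_, ?_, ?_⟩
      · rw [Finset.card_erase_add_one hxD, hcard D hDT]
      · rw [attach_clusters, hD']; exact Finset.insert_subset hDT hWT
      · intro A B h
        rw [attach_adj, hD'] at h
        rcases h with h | ⟨⟨rfl, rfl⟩ | ⟨rfl, rfl⟩, -⟩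
        · exact hWl h
        · exact hCD
        · exact hCD.symm
      · rw [attach_clusters, hD', Finset.card_insert_of_notMem hD, hWj]
  obtain ⟨W, hW, hWT, hWl, hWj⟩ := grow _ hne.card_pos le_rfl
  have hcl : W.clusters = T.clusters := Finset.eq_of_subset_of_card_le hWT hWj.ge
  have hll : W.links = T.links := by
    refine Finset.eq_of_subset_of_card_le (fun e he => ?_) ?_
    · rw [mem_links] at he ⊢
      exact SimpleGraph.edgeSet_mono hWl he
    · have := hW.card_links; omega
  have hlin : W.linked = T.linked := by
    ext A B
    rw [← mk_mem_links, ← mk_mem_links, hll]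
  have : W = T := ClusterTree.ext hcl hlin
  exact this ▸ hW

section Fintype

variable [Fintype V]

lemma Covers.sup_eq_univ (h : T.Covers) : T.clusters.sup id = Finset.univ := by
  ext v
  obtain ⟨K, hK, hv⟩ := h v
  exact ⟨fun _ => Finset.mem_univ v, fun _ => Finset.le_sup (f := id) hK hv⟩

lemma IsTCherry.card_univ (h : T.IsTCherry k) (hc : T.Covers) :
    Fintype.card V + 1 = k + T.clusters.card := by
  rw [← h.card_sup, hc.sup_eq_univ, Finset.card_univ]

end Fintype

/-! ### One pass of the algorithm -/

lemma SeparatorAt.subset {S K : Finset V} (h : T.SeparatorAt S K) : S ⊆ K := by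
  obtain ⟨L, -, rfl⟩ := h
  exact Finset.inter_subset_left

lemma SeparatorAt.mem_clusters {S K : Finset V} (h : T.SeparatorAt S K) : K ∈ T.clusters := by
  obtain ⟨L, h, rfl⟩ := h
  exact T.mem_of_linked K L h

lemma IsTCherry.card_separatorAt (h : T.IsTCherry k) {S K : Finset V} (hS : T.SeparatorAt S K) :
    S.card + 1 = k := by
  obtain ⟨L, hL, rfl⟩ := hS
  exact h.card_inter hL

lemma IsSimplicial.notMem_separatorAt {v : V} (hv : T.IsSimplicial v) {S K : Finset V}
    (hS : T.SeparatorAt S K) : v ∉ S := by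
  obtain ⟨L, hL, rfl⟩ := hS
  intro h
  rw [Finset.mem_inter] at h
  exact hL.ne (hv.unique ⟨T.mem_of_linked K L hL, h.1⟩ ⟨right_mem_of_linked hL, h.2⟩)

/-- The only separator at a leaf cluster consists of all its vertices but a simplicial
one. -/
lemma IsTCherry.separatorAt_eq_erase (h : T.IsTCherry k) {S K : Finset V} {v : V}
    (hS : T.SeparatorAt S K) (hvK : v ∈ K) (hv : T.IsSimplicial v) : S = K.erase v := by
  refine Finset.eq_of_subset_of_card_le
    (fun w hw => Finset.mem_erase.2 ⟨?_, hS.subset hw⟩) ?_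
  · rintro rfl
    exact hv.notMem_separatorAt hS hw
  · have := h.card_separatorAt hS
    have := h.card_eq hS.mem_clusters
    rw [Finset.card_erase_of_mem hvK]
    omega

/-- The separators at a cluster `K` and, if `K` is a leaf cluster, its reduction: the clusters
which arise from `K` in one pass of the algorithm. -/
def IsPart (T : ClusterTree V) (y : Finset V → V) (K A : Finset V) : Prop :=
  T.SeparatorAt A K ∨ K ∈ T.leafClusters ∧ A = K.erase (y K)

lemma IsPart.mem_clusters {y : Finset V → V} {K A : Finset V} (h : T.IsPart y K A) :
    K ∈ T.clusters := by
  rcases h with h | ⟨h, -⟩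
  · exact h.mem_clusters
  · exact (mem_leafClusters.1 h).1

lemma IsPart.subset {y : Finset V → V} {K A : Finset V} (h : T.IsPart y K A) : A ⊆ K := by
  rcases h with h | ⟨-, rfl⟩
  · exact h.subset
  · exact Finset.erase_subset _ _

lemma IsPart.card {y : Finset V → V} (hT : T.IsTCherry (m + 1)) (hy : ∀ K ∈ T.leafClusters, y K ∈ K)
    {K A : Finset V} (h : T.IsPart y K A) : A.card = m := by
  have hK := hT.card_eq h.mem_clusters
  rcases h with h | ⟨h, rfl⟩
  · have := hT.card_separatorAt h; omega
  · rw [Finset.card_erase_of_mem (hy K h), hK]; rfl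

section Fintype

variable [Fintype V]

section Reduce

variable {y : Finset V → V}

lemma SeparatorAt.mem_separators {S K : Finset V} (h : T.SeparatorAt S K) :
    S ∈ T.separators := by
  obtain ⟨L, h, rfl⟩ := h
  exact ClusterTree.mem_separators.2 ⟨s(K, L), mk_mem_links.2 h, rfl⟩

lemma exists_separatorAt {S : Finset V} (h : S ∈ T.separators) : ∃ K, T.SeparatorAt S K := by
  obtain ⟨e, he, rfl⟩ := ClusterTree.mem_separators.1 h
  induction e with | _ A B => exact ⟨A, B, mk_mem_links.1 he, rfl⟩

lemma mem_reduce_clusters {A : Finset V} : A ∈ (T.reduce y).clusters ↔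
    A ∈ T.separators ∨ ∃ K ∈ T.leafClusters, K.erase (y K) = A := by
  unfold reduce
  classical
  rw [Finset.mem_union, Finset.mem_image]

lemma reduce_adj {A B : Finset V} : (T.reduce y).linked.Adj A B ↔ A ≠ B ∧
    ((∃ K, T.SeparatorAt A K ∧ T.SeparatorAt B K) ∨
      (∃ K ∈ T.leafClusters, A = K.erase (y K) ∧ T.SeparatorAt B K) ∨
      (∃ K ∈ T.leafClusters, B = K.erase (y K) ∧ T.SeparatorAt A K)) := by
  unfold reduce
  rw [SimpleGraph.fromRel_adj]
  constructor
  · rintro ⟨hne, (⟨K, h1, h2⟩ | h) | ⟨K, h1, h2⟩ | h⟩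
    · exact ⟨hne, Or.inl ⟨K, h1, h2⟩⟩
    · exact ⟨hne, Or.inr (Or.inl h)⟩
    · exact ⟨hne, Or.inl ⟨K, h2, h1⟩⟩
    · exact ⟨hne, Or.inr (Or.inr h)⟩
  · rintro ⟨hne, ⟨K, h1, h2⟩ | h | h⟩
    · exact ⟨hne, Or.inl (Or.inl ⟨K, h1, h2⟩)⟩
    · exact ⟨hne, Or.inl (Or.inr h)⟩
    · exact ⟨hne, Or.inr (Or.inr h)⟩

lemma two_le_card_clusters (hT : T.IsTCherry k) (hsep : T.SeparatorsFormTCherry m) :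
    2 ≤ T.clusters.card := by
  obtain ⟨U, hU, hU'⟩ := hsep
  obtain ⟨S, hS⟩ := hU'.clusters_nonempty
  rw [hU, ClusterTree.mem_separators] at hS
  obtain ⟨e, he, -⟩ := hS
  have := Finset.card_pos.2 ⟨e, he⟩
  have := hT.card_links
  omega

lemma IsPart.mem_reduce {K A : Finset V} (h : T.IsPart y K A) : A ∈ (T.reduce y).clusters := by
  rw [mem_reduce_clusters]
  rcases h with h | ⟨h, rfl⟩
  · exact Or.inl h.mem_separators
  · exact Or.inr ⟨K, h, rfl⟩

lemma exists_isPart {A : Finset V} (h : A ∈ (T.reduce y).clusters) : ∃ K, T.IsPart y K A := by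
  rw [mem_reduce_clusters] at h
  rcases h with h | ⟨K, h, rfl⟩
  · obtain ⟨K, hK⟩ := exists_separatorAt h
    exact ⟨K, Or.inl hK⟩
  · exact ⟨K, Or.inr ⟨h, rfl⟩⟩

/-- Only because the separators form a `t`-cherry junction tree are there at most two of them at a
cluster. -/
lemma IsPart.eq_or_eq (hT : T.IsTCherry (m + 1)) (hsep : T.SeparatorsFormTCherry m)
    {K A B C : Finset V} (hA : T.IsPart y K A) (hB : T.IsPart y K B) (hC : T.IsPart y K C) :
    A = B ∨ A = C ∨ B = C := by
  by_cases hK : K ∈ T.leafClusters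
  · obtain ⟨v, hvK, hv⟩ := (mem_leafClusters.1 hK).2
    have key : ∀ A, T.IsPart y K A → A = K.erase v ∨ A = K.erase (y K) := fun A hA =>
      hA.imp (fun h => hT.separatorAt_eq_erase h hvK hv) fun h => h.2
    rcases key A hA with rfl | rfl <;> rcases key B hB with rfl | rfl <;>
      rcases key C hC with rfl | rfl <;> simp
  · have key : ∀ A, T.IsPart y K A → T.SeparatorAt A K := fun A hA =>
      hA.resolve_right fun h => hK h.1
    obtain ⟨U, hU, hU'⟩ := hsep
    have hmem : ∀ A, T.IsPart y K A → A ∈ U.clusters := fun A hA =>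
      hU ▸ (key A hA).mem_separators
    exact hU'.eq_or_eq_of_subset_card (hT.card_eq hA.mem_clusters) (hmem A hA) (hmem B hB)
      (hmem C hC) hA.subset hB.subset hC.subset

lemma exists_isPart_of_reduce_adj {A B : Finset V} (h : (T.reduce y).linked.Adj A B) :
    ∃ K, T.IsPart y K A ∧ T.IsPart y K B := by
  rcases (reduce_adj.1 h).2 with ⟨K, h1, h2⟩ | ⟨K, h1, h2, h3⟩ | ⟨K, h1, h2, h3⟩
  · exact ⟨K, Or.inl h1, Or.inl h2⟩
  · exact ⟨K, Or.inr ⟨h1, h2⟩, Or.inl h3⟩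
  · exact ⟨K, Or.inl h3, Or.inr ⟨h1, h2⟩⟩

lemma isPart_union_of_reduce_adj (hT : T.IsTCherry (m + 1))
    (hy : ∀ K ∈ T.leafClusters, y K ∈ K) {A B : Finset V} (h : (T.reduce y).linked.Adj A B) :
    T.IsPart y (A ∪ B) A ∧ T.IsPart y (A ∪ B) B := by
  obtain ⟨K, hA, hB⟩ := exists_isPart_of_reduce_adj h
  have hAB : A ∪ B = K := by
    refine Finset.eq_of_subset_of_card_le (Finset.union_subset hA.subset hB.subset) ?_
    rw [hT.card_eq hA.mem_clusters]
    by_contra hlt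
    have hA' := hA.card hT hy
    have h1 : A = A ∪ B :=
      Finset.eq_of_subset_of_card_le Finset.subset_union_left (by omega)
    have h2 : B = A ∪ B :=
      Finset.eq_of_subset_of_card_le Finset.subset_union_right (by
        have := hB.card hT hy; omega)
    exact h.ne (h1.trans h2.symm)
  exact hAB ▸ ⟨hA, hB⟩

lemma linkUnion_injOn_reduce (hT : T.IsTCherry (m + 1)) (hsep : T.SeparatorsFormTCherry m)
    (hy : ∀ K ∈ T.leafClusters, y K ∈ K) :
    Set.InjOn linkUnion ((T.reduce y).links : Set (Sym2 (Finset V))) := by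
  intro e he e' he' heq
  induction e with | _ A B =>
  induction e' with | _ A' B' =>
  rw [Finset.mem_coe, mk_mem_links] at he he'
  rw [linkUnion_mk, linkUnion_mk] at heq
  obtain ⟨hA, hB⟩ := isPart_union_of_reduce_adj hT hy he
  obtain ⟨hA', hB'⟩ := isPart_union_of_reduce_adj hT hy he'
  rw [← heq] at hA' hB'
  rw [Sym2.eq_iff]
  have h1 := (hA.eq_or_eq hT hsep hB hA').resolve_left he.ne
  have h2 := (hA.eq_or_eq hT hsep hB hB').resolve_left he.ne
  have h3 := he'.ne
  rcases h1 with rfl | rfl <;> rcases h2 with rfl | rfl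
  · exact absurd rfl h3
  · exact Or.inl ⟨rfl, rfl⟩
  · exact Or.inr ⟨rfl, rfl⟩
  · exact absurd rfl h3

lemma linkUnion_mem_of_mem_reduce (hT : T.IsTCherry (m + 1))
    (hy : ∀ K ∈ T.leafClusters, y K ∈ K) {e : Sym2 (Finset V)}
    (he : e ∈ (T.reduce y).links) : linkUnion e ∈ T.clusters := by
  induction e with | _ A B =>
  exact (isPart_union_of_reduce_adj hT hy (mk_mem_links.1 he)).1.mem_clusters

lemma card_links_reduce_le (hT : T.IsTCherry (m + 1)) (hsep : T.SeparatorsFormTCherry m)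
    (hy : ∀ K ∈ T.leafClusters, y K ∈ K) :
    (T.reduce y).links.card ≤ T.clusters.card :=
  Finset.card_le_card_of_injOn linkUnion (fun _ he => linkUnion_mem_of_mem_reduce hT hy he)
    (linkUnion_injOn_reduce hT hsep hy)

lemma reduce_covers (hT : T.IsTCherry (m + 1)) (hcov : T.Covers)
    (hy : ∀ K ∈ T.leafClusters, ¬ T.IsSimplicial (y K)) : (T.reduce y).Covers := by
  intro v
  obtain ⟨K, hK, hvK⟩ := hcov v
  by_cases hv : T.IsSimplicial v
  · have hKl : K ∈ T.leafClusters := mem_leafClusters.2 ⟨hK, v, hvK, hv⟩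
    refine ⟨K.erase (y K), mem_reduce_clusters.2 (Or.inr ⟨K, hKl, rfl⟩),
      Finset.mem_erase.2 ⟨?_, hvK⟩⟩
    rintro rfl
    exact hy K hKl hv
  · -- two clusters contain `v`, so by the running intersection property a separator does
    have h1 := hT.card_filter_subset (R := {v}) ⟨K, hK, by simpa using hvK⟩
    have h2 : (T.links.filter ({v} ⊆ linkSep ·)).Nonempty := by
      rw [← Finset.card_pos]
      by_contra h0
      have h3 : (T.clusters.filter ({v} ⊆ ·)).card = 1 := by omega
      obtain ⟨K', hK'⟩ := Finset.card_eq_one.1 h3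
      refine hv ⟨K, ⟨hK, hvK⟩, fun L hL => ?_⟩
      have hmem : ∀ L ∈ T.clusters, v ∈ L → L = K' := fun L hL hvL =>
        Finset.mem_singleton.1 (hK' ▸ Finset.mem_filter.2 ⟨hL, by simpa using hvL⟩)
      rw [hmem L hL.1 hL.2, hmem K hK hvK]
    obtain ⟨e, he⟩ := h2
    rw [Finset.mem_filter, Finset.singleton_subset_iff] at he
    exact ⟨linkSep e, mem_reduce_clusters.2 (Or.inl (mem_separators.2 ⟨e, he.1, rfl⟩)), he.2⟩

lemma reduce_reachable_of_separatorAt {K A B : Finset V} (hA : T.SeparatorAt A K)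
    (hB : T.SeparatorAt B K) : (T.reduce y).linked.Reachable A B := by
  by_cases h : A = B
  · rw [h]
  · exact (reduce_adj.2 ⟨h, Or.inl ⟨K, hA, hB⟩⟩).reachable

lemma reduce_reachable_of_walk {K L : Finset V} (p : T.linked.Walk K L) {A B : Finset V}
    (hA : T.SeparatorAt A K) (hB : T.SeparatorAt B L) :
    (T.reduce y).linked.Reachable A B := by
  induction p generalizing A with
  | nil => exact reduce_reachable_of_separatorAt hA hB
  | @cons K K' L h p ih =>
    exact (reduce_reachable_of_separatorAt (B := K ∩ K') hA ⟨K', h, rfl⟩).trans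
      (ih ⟨K, h.symm, Finset.inter_comm _ _⟩ hB)

lemma reduce_reachable (hT : T.IsTCherry (m + 1)) (h2 : 2 ≤ T.clusters.card)
    {A B : Finset V} (hA : A ∈ (T.reduce y).clusters) (hB : B ∈ (T.reduce y).clusters) :
    (T.reduce y).linked.Reachable A B := by
  have key : ∀ A ∈ (T.reduce y).clusters, ∃ S K, T.SeparatorAt S K ∧
      (T.reduce y).linked.Reachable A S := by
    intro A hA
    obtain ⟨K, h | ⟨hK, rfl⟩⟩ := exists_isPart hA
    · exact ⟨A, K, h, .refl A⟩
    · obtain ⟨L, hL⟩ := hT.exists_linked h2 (mem_leafClusters.1 hK).1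
      refine ⟨K ∩ L, K, ⟨L, hL, rfl⟩, ?_⟩
      by_cases h : K.erase (y K) = K ∩ L
      · rw [h]
      · exact (reduce_adj.2 ⟨h, Or.inr (Or.inl ⟨K, hK, rfl, L, hL, rfl⟩)⟩).reachable
  obtain ⟨S, K, hS, hAS⟩ := key A hA
  obtain ⟨S', K', hS', hBS'⟩ := key B hB
  obtain ⟨p⟩ := hT.reachable hS.mem_clusters hS'.mem_clusters
  exact (hAS.trans (reduce_reachable_of_walk p hS hS')).trans hBS'.symm

/-- The separators cover the non-simplicial vertices only, and each leaf cluster has a simplicial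
vertex of its own. -/
lemma card_reduce_clusters_le (hsep : T.SeparatorsFormTCherry m) :
    m + (T.reduce y).clusters.card ≤ Fintype.card V + 1 := by
  classical
  obtain ⟨U, hU, hU'⟩ := hsep
  have hcard : (T.reduce y).clusters.card ≤ T.separators.card + T.leafClusters.card := by
    unfold reduce
    exact (Finset.card_union_le _ _).trans (Nat.add_le_add_left Finset.card_image_le _)
  have hsup := hU'.card_sup
  rw [hU] at hsup
  let s : Finset V := Finset.univ.filter fun v => T.IsSimplicial v
  have hleaf : T.leafClusters.card ≤ s.card := by
    have : Nonempty V := ⟨y ∅⟩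
    choose! f hf hf' using fun K (hK : K ∈ T.leafClusters) => (mem_leafClusters.1 hK).2
    refine Finset.card_le_card_of_injOn f (fun K hK => by simpa [s] using hf' K hK) ?_
    intro K hK K' hK' heq
    exact (hf' K hK).unique ⟨(mem_leafClusters.1 hK).1, hf K hK⟩
      ⟨(mem_leafClusters.1 hK').1, heq ▸ hf K' hK'⟩
  have hdisj : Disjoint (T.separators.sup id) s := by
    rw [Finset.disjoint_left]
    intro v hv hvs
    obtain ⟨S, hS, hvS⟩ := Finset.mem_sup.1 hv
    obtain ⟨K, hK⟩ := exists_separatorAt hS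
    exact (Finset.mem_filter.1 hvs).2.notMem_separatorAt hK hvS
  have := Finset.card_le_univ (T.separators.sup id ∪ s)
  rw [Finset.card_union_of_disjoint hdisj] at this
  omega

/-- One pass of the algorithm turns a `t`-cherry junction tree of order `m + 1` into one of order
`m`. -/
theorem isTCherry_reduce (hT : T.IsTCherry (m + 1)) (hcov : T.Covers)
    (hsep : T.SeparatorsFormTCherry m)
    (hy : ∀ K ∈ T.leafClusters, y K ∈ K ∧ ¬ T.IsSimplicial (y K)) :
    (T.reduce y).IsTCherry m := by
  have hy1 := fun K hK => (hy K hK).1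
  have hcov' := reduce_covers hT hcov fun K hK => (hy K hK).2
  have hcards : ∀ A ∈ (T.reduce y).clusters, A.card = m := fun A hA => by
    obtain ⟨K, hK⟩ := exists_isPart hA
    exact hK.card hT hy1
  have hadj : ∀ A B, (T.reduce y).linked.Adj A B → (B \ A).card ≤ 1 := by
    intro A B h
    obtain ⟨hA, hB⟩ := isPart_union_of_reduce_adj hT hy1 h
    have h1 := hT.card_eq hA.mem_clusters
    have h2 := hA.card hT hy1
    have h3 := Finset.card_sdiff_add_card B A
    rw [Finset.union_comm] at h3
    omega
  have h2 := two_le_card_clusters hT hsep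
  have hne : (T.reduce y).clusters.Nonempty := by
    obtain ⟨K, hK⟩ := hT.clusters_nonempty
    obtain ⟨L, hL⟩ := hT.exists_linked h2 hK
    exact ⟨K ∩ L, IsPart.mem_reduce (K := K) (Or.inl ⟨L, hL, rfl⟩)⟩
  have hconn : ∀ A ∈ (T.reduce y).clusters, ∀ B ∈ (T.reduce y).clusters,
      (T.reduce y).linked.Reachable A B := fun A hA B hB => reduce_reachable hT h2 hA hB
  have hle := card_reduce_clusters_le (y := y) hsep
  -- since the reduced tree is connected and covers `V`, it has enough clusters
  have hge : Fintype.card V + 1 ≤ m + (T.reduce y).clusters.card := by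
    obtain ⟨A, hA⟩ := hne
    have := card_sup_le_of_connected hadj hconn ((T.reduce y).clusters.card - 1) {A}
      (Finset.singleton_nonempty A) (Finset.singleton_subset_iff.2 hA)
      (by rw [Finset.card_singleton]; have := Finset.card_pos.2 ⟨A, hA⟩; omega)
    rw [hcov'.sup_eq_univ, Finset.card_univ, Finset.sup_singleton, id, hcards A hA] at this
    have := Finset.card_pos.2 ⟨A, hA⟩
    omega
  refine isTCherry_of_card hne hcards hadj hconn ?_ ?_
  · rwa [hcov'.sup_eq_univ, Finset.card_univ]
  · have h3 := card_links_reduce_le hT hsep hy1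
    have h4 := hT.card_univ hcov
    omega

end Reduce

lemma IsTCherry.card_clusters_succ {T' : ClusterTree V} (h : T.IsTCherry m) (hc : T.Covers)
    (h' : T'.IsTCherry (m + 1)) (hc' : T'.Covers) : T'.clusters.card = T.links.card := by
  have := h.card_univ hc
  have := h'.card_univ hc'
  have := h.card_links
  omega

/-- The union property of regular vines holds for one pass of the algorithm. -/
theorem exists_union_of_reduce {y : Finset V → V} (hT : T.IsTCherry (m + 1)) (hcov : T.Covers)
    (hsep : T.SeparatorsFormTCherry m)
    (hy : ∀ K ∈ T.leafClusters, y K ∈ K ∧ ¬ T.IsSimplicial (y K)) {K : Finset V}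
    (hK : K ∈ T.clusters) : ∃ A B, (T.reduce y).linked.Adj A B ∧ K = A ∪ B := by
  have hy1 := fun K hK => (hy K hK).1
  have himg : (T.reduce y).links.image linkUnion = T.clusters := by
    refine Finset.eq_of_subset_of_card_le (fun K hK => ?_) ?_
    · obtain ⟨e, he, rfl⟩ := Finset.mem_image.1 hK
      exact linkUnion_mem_of_mem_reduce hT hy1 he
    · rw [Finset.card_image_of_injOn (linkUnion_injOn_reduce hT hsep hy1),
        (isTCherry_reduce hT hcov hsep hy).card_clusters_succ
          (reduce_covers hT hcov fun K hK => (hy K hK).2) hT hcov]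
  rw [← himg] at hK
  obtain ⟨e, he, rfl⟩ := Finset.mem_image.1 hK
  induction e with | _ A B => exact ⟨A, B, mk_mem_links.1 he, rfl⟩

/-! ### Extending a regular vine structure -/

/-- Each `t`-cherry junction tree with at least two clusters can be followed by a next tree of a
regular vine: a new link `L`, `L ∪ {x}` gives a cluster which is attached to `L ∪ L'`, where `L'`
is an older neighbour of `L`. -/
theorem IsTCherry.exists_succ (h : T.IsTCherry m) (h2 : 2 ≤ T.clusters.card) :
    ∃ T' : ClusterTree V, T'.IsTCherry (m + 1) ∧ T'.clusters = T.links.image linkUnion := by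
  induction h with
  | single K hK => simp at h2
  | extend T hT L S x hL hS hcard hx ih =>
    have hxL := hx L hL
    have hK := insert_notMem_clusters hx S
    have hU : L ∪ insert x S = insert x L := by
      rw [Finset.union_insert, Finset.union_eq_left.2 hS]
    have hLc := hT.card_eq hL
    rw [links_attach hL hK, Finset.image_insert, linkUnion_mk, hU]
    by_cases h1 : 2 ≤ T.clusters.card
    · obtain ⟨T', hT', hcl⟩ := ih h1
      obtain ⟨L', hL'⟩ := hT.exists_linked h1 hL
      have hmem : L ∪ L' ∈ T'.clusters := by
        rw [hcl]; exact Finset.mem_image.2 ⟨s(L, L'), mk_mem_links.2 hL', rfl⟩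
      refine ⟨T'.attach (L ∪ L') (insert x L) hmem, .extend T' hT' _ L x hmem
        Finset.subset_union_left (by rw [hLc]) ?_, by rw [attach_clusters, hcl]⟩
      intro K hK hxK
      rw [hcl] at hK
      obtain ⟨e, he, rfl⟩ := Finset.mem_image.1 hK
      induction e with | _ A B =>
      rw [mk_mem_links] at he
      rcases Finset.mem_union.1 hxK with hxA | hxB
      · exact hx A (T.mem_of_linked A B he) hxA
      · exact hx B (right_mem_of_linked he) hxB
    · have h0 : T.links = ∅ := by
        rw [← Finset.card_eq_zero]
        have := hT.card_links
        omega
      refine ⟨ClusterTree.single (insert x L), .single _ ?_, by rw [h0]; simp⟩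
      rw [Finset.card_insert_of_notMem hxL, hLc]

lemma Covers.of_image_linkUnion {T' : ClusterTree V} (hc : T.Covers) (h : T.IsTCherry m)
    (h2 : 2 ≤ T.clusters.card) (hcl : T'.clusters = T.links.image linkUnion) : T'.Covers := by
  intro v
  obtain ⟨K, hK, hv⟩ := hc v
  obtain ⟨L, hL⟩ := h.exists_linked h2 hK
  exact ⟨K ∪ L, hcl ▸ Finset.mem_image.2 ⟨s(K, L), mk_mem_links.2 hL, rfl⟩,
    Finset.mem_union_left _ hv⟩

end Fintype

end ClusterTree

namespace ClusterTree

variable {V : Type*} [DecidableEq V] {k m : ℕ} {T T' : ClusterTree V}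

/-! ### The first tree -/

lemma IsTCherry.ne_of_pair_mem (h : T.IsTCherry 2) {a b : V}
    (hab : ({a, b} : Finset V) ∈ T.clusters) : a ≠ b := by
  rintro rfl
  have := h.card_eq hab
  simp at this

lemma IsTCherry.firstTree_adj (h : T.IsTCherry 2) {a b : V} :
    T.firstTree.Adj a b ↔ ({a, b} : Finset V) ∈ T.clusters := by
  rw [firstTree, SimpleGraph.fromRel_adj, Finset.pair_comm b a, or_self, and_iff_right_iff_imp]
  exact h.ne_of_pair_mem

lemma IsTCherry.mem_clusters_iff_firstTree (h : T.IsTCherry 2) (K : Finset V) :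
    K ∈ T.clusters ↔ ∃ a b, T.firstTree.Adj a b ∧ K = {a, b} := by
  constructor
  · intro hK
    obtain ⟨a, b, -, rfl⟩ := Finset.card_eq_two.1 (h.card_eq hK)
    exact ⟨a, b, h.firstTree_adj.2 hK, rfl⟩
  · rintro ⟨a, b, hab, rfl⟩
    exact h.firstTree_adj.1 hab

lemma IsTCherry.firstTree_reachable (h : T.IsTCherry 2) {K : Finset V} (hK : K ∈ T.clusters)
    {a b : V} (ha : a ∈ K) (hb : b ∈ K) : T.firstTree.Reachable a b := by
  by_cases hab : a = b
  · rw [hab]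
  · refine (h.firstTree_adj.2 ?_).reachable
    have : ({a, b} : Finset V) = K := by
      refine Finset.eq_of_subset_of_card_le (Finset.insert_subset ha (by simpa using hb)) ?_
      rw [h.card_eq hK, Finset.card_pair hab]
    rwa [this]

lemma IsTCherry.firstTree_reachable_of_walk (h : T.IsTCherry 2) {K L : Finset V}
    (p : T.linked.Walk K L) (hK : K ∈ T.clusters) {a b : V} (ha : a ∈ K) (hb : b ∈ L) :
    T.firstTree.Reachable a b := by
  induction p generalizing a with
  | nil => exact h.firstTree_reachable hK ha hb
  | @cons K K' L hKK p ih =>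
    obtain ⟨c, hc⟩ : (K ∩ K').Nonempty := by
      rw [← Finset.card_pos]
      have := h.card_inter hKK
      omega
    rw [Finset.mem_inter] at hc
    exact (h.firstTree_reachable hK ha hc.1).trans (ih (right_mem_of_linked hKK) hc.2 hb)

lemma IsTCherry.image_toFinset_firstTree (h : T.IsTCherry 2) [Fintype T.firstTree.edgeSet] :
    T.firstTree.edgeFinset.image Sym2.toFinset = T.clusters := by
  ext K
  rw [h.mem_clusters_iff_firstTree, Finset.mem_image]
  constructor
  · rintro ⟨e, he, rfl⟩
    induction e with | _ a b =>
    exact ⟨a, b, by simpa using he, by ext; simp [Sym2.mem_toFinset]⟩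
  · rintro ⟨a, b, hab, rfl⟩
    exact ⟨s(a, b), by simpa using hab, by ext; simp [Sym2.mem_toFinset]⟩

lemma sym2_toFinset_injective {α : Type*} [DecidableEq α] :
    Function.Injective (Sym2.toFinset : Sym2 α → Finset α) := by
  intro e e' h
  refine Sym2.ext fun x => ?_
  rw [← Sym2.mem_toFinset, h, Sym2.mem_toFinset]

lemma IsTCherry.prod_firstTree {M : Type*} [CommMonoid M] (h : T.IsTCherry 2)
    [Fintype T.firstTree.edgeSet] (g : Finset V → M) :
    ∏ e ∈ T.firstTree.edgeFinset, g e.toFinset = ∏ K ∈ T.clusters, g K := by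
  rw [← h.image_toFinset_firstTree, Finset.prod_image sym2_toFinset_injective.injOn]

section Fintype

variable [Fintype V]

theorem IsTCherry.isTree_firstTree (h : T.IsTCherry 2) (hc : T.Covers) :
    T.firstTree.IsTree := by
  classical
  obtain ⟨K, hK⟩ := h.clusters_nonempty
  obtain ⟨v, -⟩ : K.Nonempty := by
    rw [← Finset.card_pos, h.card_eq hK]; norm_num
  rw [SimpleGraph.isTree_iff_connected_and_card]
  constructor
  · have : Nonempty V := ⟨v⟩
    refine SimpleGraph.Connected.mk fun a b => ?_
    obtain ⟨A, hA, ha⟩ := hc a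
    obtain ⟨B, hB, hb⟩ := hc b
    obtain ⟨p⟩ := h.reachable hA hB
    exact h.firstTree_reachable_of_walk p hA ha hb
  · have h1 : T.firstTree.edgeFinset.card = T.clusters.card := by
      rw [← h.image_toFinset_firstTree, Finset.card_image_of_injective _ sym2_toFinset_injective]
    have h2 := h.card_univ hc
    rw [Nat.card_eq_fintype_card, Nat.card_eq_fintype_card, ← SimpleGraph.edgeFinset_card, h1]
    omega

/-! ### Consecutive trees of a regular vine -/

/-- In a regular vine each cluster of one tree is the union of exactly one link of the tree
before. -/
lemma IsTCherry.links_bijOn (h : T.IsTCherry m) (hc : T.Covers)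
    (h' : T'.IsTCherry (m + 1)) (hc' : T'.Covers)
    (hu : ∀ K ∈ T'.clusters, ∃ A B, T.linked.Adj A B ∧ K = A ∪ B) :
    T.links.image linkUnion = T'.clusters ∧
      Set.InjOn linkUnion (T.links : Set (Sym2 (Finset V))) := by
  have hsub : T'.clusters ⊆ T.links.image linkUnion := by
    intro K hK
    obtain ⟨A, B, hAB, rfl⟩ := hu K hK
    exact Finset.mem_image.2 ⟨s(A, B), mk_mem_links.2 hAB, rfl⟩
  have hcard := h.card_clusters_succ hc h' hc'
  have heq := Finset.eq_of_subset_of_card_le hsub (hcard ▸ Finset.card_image_le)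
  exact ⟨heq.symm, Finset.card_image_iff.1 (by rw [← heq, hcard])⟩

lemma IsTCherry.linkSep_mem_clusters (h : T.IsTCherry m) (h' : T'.IsTCherry (m + 1))
    (hu : ∀ K ∈ T'.clusters, ∃ A B, T.linked.Adj A B ∧ K = A ∪ B)
    {e : Sym2 (Finset V)} (he : e ∈ T'.links) : linkSep e ∈ T.clusters := by
  have hcard := h'.card_linkSep he
  induction e with | _ K L =>
  rw [mk_mem_links] at he
  obtain ⟨A, B, hAB, rfl⟩ := hu K (T'.mem_of_linked K L he)
  obtain ⟨A', B', hAB', rfl⟩ := hu L (right_mem_of_linked he)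
  obtain ⟨C, hC, hsub⟩ := h.exists_inter_subset hAB hAB' he.ne
  rw [linkSep_mk] at hcard ⊢
  rwa [Finset.eq_of_subset_of_card_le hsub (by rw [h.card_eq hC]; omega)]

/-- The degree of a cluster `A` in one tree of a regular vine is one more than the number of links
of the next tree with separator `A`. -/
lemma IsTCherry.card_filter_mem_links (h : T.IsTCherry m) (hc : T.Covers)
    (h' : T'.IsTCherry (m + 1)) (hc' : T'.Covers)
    (hu : ∀ K ∈ T'.clusters, ∃ A B, T.linked.Adj A B ∧ K = A ∪ B) {A : Finset V}
    (hA : A ∈ T.clusters) :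
    (T.links.filter (A ∈ ·)).card = (T'.links.filter (linkSep · = A)).card + 1 := by
  obtain ⟨himg, hinj⟩ := h.links_bijOn hc h' hc' hu
  have hAK : ∃ C ∈ T'.clusters, A ⊆ C := by
    have h2 : 2 ≤ T.clusters.card := by
      have := h.card_links
      have := h.card_clusters_succ hc h' hc'
      have := h'.clusters_nonempty.card_pos
      omega
    obtain ⟨B, hB⟩ := h.exists_linked h2 hA
    exact ⟨A ∪ B, himg ▸ Finset.mem_image.2 ⟨s(A, B), mk_mem_links.2 hB, rfl⟩,
      Finset.subset_union_left⟩
  rw [h'.card_filter_linkSep_eq (by rw [h.card_eq hA]) hAK, nu, ← himg, Finset.filter_image,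
    Finset.card_image_of_injOn (hinj.mono (Finset.coe_subset.2 (Finset.filter_subset _ _)))]
  congr 1
  refine Finset.filter_congr fun e he => ?_
  induction e with | _ B C =>
  rw [mk_mem_links] at he
  rw [Sym2.mem_iff, linkUnion_mk]
  constructor
  · rintro (rfl | rfl)
    · exact Finset.subset_union_left
    · exact Finset.subset_union_right
  · exact h.eq_or_eq_of_subset_union he hA

lemma IsTCherry.prod_link_ends {M : Type*} [CommMonoid M] (h : T.IsTCherry m) (hc : T.Covers)
    (h' : T'.IsTCherry (m + 1)) (hc' : T'.Covers)
    (hu : ∀ K ∈ T'.clusters, ∃ A B, T.linked.Adj A B ∧ K = A ∪ B) (g : Finset V → M) :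
    ∏ e ∈ T.links, ∏ A ∈ e.toFinset, g A =
      (∏ A ∈ T.clusters, g A) * ∏ e ∈ T'.links, g (linkSep e) := by
  have h1 : ∏ e ∈ T.links, ∏ A ∈ e.toFinset, g A =
      ∏ A ∈ T.clusters, ∏ e ∈ T.links.filter (A ∈ ·), g A := by
    refine Finset.prod_comm' fun e A => ?_
    rw [Sym2.mem_toFinset, Finset.mem_filter]
    refine ⟨fun ⟨he, hA⟩ => ⟨⟨he, hA⟩, ?_⟩, fun ⟨h, _⟩ => h⟩
    induction e with | _ B C =>
    rw [mk_mem_links] at he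
    rcases Sym2.mem_iff.1 hA with rfl | rfl
    · exact T.mem_of_linked _ _ he
    · exact right_mem_of_linked he
  rw [h1, ← Finset.prod_fiberwise_of_maps_to (t := T.clusters) (g := linkSep)
    (fun e he => h.linkSep_mem_clusters h' hu he), ← Finset.prod_mul_distrib]
  refine Finset.prod_congr rfl fun A hA => ?_
  rw [Finset.prod_const, h.card_filter_mem_links hc h' hc' hu hA,
    Finset.prod_congr rfl fun e he => congrArg g (Finset.mem_filter.1 he).2, Finset.prod_const,
    pow_succ, mul_comm]

/-- The quotient of the products of `g` over the clusters and over the separators is multiplied by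
the product of the link factors `L` when passing to the next tree of a regular vine.  When `g`
vanishes at a cluster, both sides are zero. -/
theorem IsTCherry.prod_div_succ (h : T.IsTCherry m) (hc : T.Covers)
    (h' : T'.IsTCherry (m + 1)) (hc' : T'.Covers)
    (hu : ∀ K ∈ T'.clusters, ∃ A B, T.linked.Adj A B ∧ K = A ∪ B)
    (g : Finset V → ℝ≥0∞) (L : Sym2 (Finset V) → ℝ≥0∞) (hfin : ∀ K, g K ≠ ∞)
    (hmono : ∀ S K, S ⊆ K → g S = 0 → g K = 0)
    (hL : ∀ A B, T.linked.Adj A B → g A ≠ 0 → g B ≠ 0 →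
      L s(A, B) * (g A * g B) = g (A ∪ B) * g (A ∩ B)) :
    (∏ K ∈ T'.clusters, g K) / ∏ e ∈ T'.links, g (linkSep e) =
      (∏ K ∈ T.clusters, g K) / (∏ e ∈ T.links, g (linkSep e)) * ∏ e ∈ T.links, L e := by
  obtain ⟨himg, hinj⟩ := h.links_bijOn hc h' hc' hu
  by_cases hpos : ∀ A ∈ T.clusters, g A ≠ 0
  · have hprod : ∏ e ∈ T.links, (L e * ∏ A ∈ e.toFinset, g A) =
        ∏ e ∈ T.links, (g (linkUnion e) * g (linkSep e)) := by
      refine Finset.prod_congr rfl fun e he => ?_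
      induction e with | _ A B =>
      rw [mk_mem_links] at he
      rw [Sym2.toFinset_mk_eq, Finset.prod_pair he.ne, linkUnion_mk, linkSep_mk]
      exact hL A B he (hpos A (T.mem_of_linked A B he)) (hpos B (right_mem_of_linked he))
    rw [Finset.prod_mul_distrib, Finset.prod_mul_distrib, h.prod_link_ends hc h' hc' hu,
      ← Finset.prod_image (g := linkUnion) (f := g) hinj, himg] at hprod
    have hsep : ∏ e ∈ T.links, g (linkSep e) ≠ 0 := by
      refine Finset.prod_ne_zero_iff.2 fun e he h0 => ?_
      induction e with | _ A B =>
      rw [mk_mem_links] at he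
      exact hpos A (T.mem_of_linked A B he) (hmono _ _ Finset.inter_subset_left h0)
    have hsep' : ∏ e ∈ T'.links, g (linkSep e) ≠ 0 :=
      Finset.prod_ne_zero_iff.2 fun e he => hpos _ (h.linkSep_mem_clusters h' hu he)
    have hsept : ∏ e ∈ T.links, g (linkSep e) ≠ ∞ := ENNReal.prod_ne_top fun e _ => hfin _
    have hsept' : ∏ e ∈ T'.links, g (linkSep e) ≠ ∞ := ENNReal.prod_ne_top fun e _ => hfin _
    rw [← ENNReal.mul_div_right_comm, ENNReal.div_eq_div_iff hsep hsept hsep' hsept',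
      mul_comm, ← hprod]
    ring
  · push Not at hpos
    obtain ⟨A, hA, hA0⟩ := hpos
    have hAK : ∃ K ∈ T'.clusters, A ⊆ K := by
      have h0 := h.card_filter_mem_links hc h' hc' hu hA
      obtain ⟨e, he⟩ := Finset.card_pos.1 (show 0 < (T.links.filter (A ∈ ·)).card by omega)
      rw [Finset.mem_filter] at he
      refine ⟨linkUnion e, himg ▸ Finset.mem_image_of_mem _ he.1, ?_⟩
      obtain ⟨he, hAe⟩ := he
      induction e with | _ B C =>
      rcases Sym2.mem_iff.1 hAe with rfl | rfl
      · exact Finset.subset_union_left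
      · exact Finset.subset_union_right
    obtain ⟨K, hK, hAK⟩ := hAK
    rw [Finset.prod_eq_zero hA hA0, Finset.prod_eq_zero hK (hmono A K hAK hA0)]
    simp

end Fintype

end ClusterTree

section Vine

variable {V : Type*} [Fintype V] [DecidableEq V] {T₁ : SimpleGraph V} {T : ℕ → ClusterTree V}

/-- A regular vine structure up to some level extends to a complete one. -/
theorem IsRVineStructure.exists_complete {k : ℕ} (hk : 2 ≤ k) (hkV : k < Fintype.card V)
    (h : IsRVineStructure T₁ T k) : ∃ T' : ℕ → ClusterTree V, (∀ m ≤ k, T' m = T m) ∧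
      IsRVineStructure T₁ T' (Fintype.card V - 1) := by
  suffices H : ∀ q, k ≤ q → q < Fintype.card V → ∃ T' : ℕ → ClusterTree V,
      (∀ m ≤ k, T' m = T m) ∧ IsRVineStructure T₁ T' q from H _ (by omega) (by omega)
  intro q hq
  induction q, hq using Nat.le_induction with
  | base => exact fun _ => ⟨T, fun _ _ => rfl, h⟩
  | succ q hq ih =>
    intro hqV
    obtain ⟨T', hT', hv⟩ := ih (by omega)
    have hc := hv.isTCherry q (by omega) le_rfl
    have hcov := hv.covers q (by omega) le_rfl
    have h2 : 2 ≤ (T' q).clusters.card := by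
      have := hc.card_univ hcov
      omega
    obtain ⟨W, hW, hWcl⟩ := hc.exists_succ h2
    have hne : ∀ m, m ≤ q → Function.update T' (q + 1) W m = T' m := fun m hm =>
      Function.update_of_ne (by omega) _ _
    have heq : Function.update T' (q + 1) W (q + 1) = W := Function.update_self _ _ _
    refine ⟨Function.update T' (q + 1) W, fun m hm => (hne m (by omega)).trans (hT' m hm),
      hv.isTree, fun _ => ?_, fun m hm hmq => ?_, fun m hm hmq => ?_, fun m hm hmq => ?_⟩
    · rw [hne 2 (by omega)]; exact hv.edges (by omega)
    · rcases Nat.lt_or_ge q m with hlt | hle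
      · obtain rfl : m = q + 1 := by omega
        rwa [heq]
      · rw [hne m hle]; exact hv.isTCherry m hm hle
    · rcases Nat.lt_or_ge q m with hlt | hle
      · obtain rfl : m = q + 1 := by omega
        rw [heq]; exact hcov.of_image_linkUnion hc h2 hWcl
      · rw [hne m hle]; exact hv.covers m hm hle
    · rcases Nat.lt_or_ge m q with hlt | hle
      · rw [hne m hlt.le, hne (m + 1) (by omega)]; exact hv.union m hm hlt
      · obtain rfl : m = q := by omega
        rw [hne m le_rfl, heq, hWcl]
        intro K hK
        obtain ⟨e, he, rfl⟩ := Finset.mem_image.1 hK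
        induction e with | _ A B =>
        exact ⟨A, B, ClusterTree.mk_mem_links.1 he, rfl⟩

/-- The trees produced by the algorithm form a regular vine structure. -/
theorem isRVineStructure_of_algorithm {k : ℕ} (hk : 2 ≤ k)
    (hT : (T k).IsTCherry k) (hcov : (T k).Covers)
    (hrun : ∀ m, 2 ≤ m → m < k → (T (m + 1)).AlgorithmStep (T m))
    (hsep : ∀ m, 1 ≤ m → m < k → (T (m + 1)).SeparatorsFormTCherry m) :
    IsRVineStructure (T 2).firstTree T k := by
  have main : ∀ m, m ≤ k → 2 ≤ m → (T m).IsTCherry m ∧ (T m).Covers := by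
    intro m hm
    induction hm using Nat.decreasingInduction with
    | self => exact fun _ => ⟨hT, hcov⟩
    | of_succ m hm ih =>
      intro h2
      obtain ⟨hT', hc'⟩ := ih (by omega)
      obtain ⟨y, hy, heq⟩ := hrun m h2 hm
      rw [heq]
      exact ⟨ClusterTree.isTCherry_reduce hT' hc' (hsep m (by omega) hm) hy,
        ClusterTree.reduce_covers hT' hc' fun K hK => (hy K hK).2⟩
  obtain ⟨h2, hc2⟩ := main 2 hk le_rfl
  refine ⟨h2.isTree_firstTree hc2, fun _ => h2.mem_clusters_iff_firstTree,
    fun m hm hmk => (main m hmk hm).1, fun m hm hmk => (main m hmk hm).2, fun m hm hmk K hK => ?_⟩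
  obtain ⟨hT', hc'⟩ := main (m + 1) hmk (by omega)
  obtain ⟨y, hy, heq⟩ := hrun m hm hmk
  rw [heq]
  exact ClusterTree.exists_union_of_reduce hT' hc' (hsep m (by omega) hmk) hy hK

end Vine

/-! ### Densities of image measures and of product measures -/

/-- Radon-Nikodym derivatives are carried along by a map which is injective up to null sets. -/
lemma rnDeriv_map_comp_of_leftInverse {X Y : Type*} [MeasurableSpace X] [MeasurableSpace Y]
    {μ ν : Measure X} [IsFiniteMeasure μ] [IsFiniteMeasure ν] (hν : ν ≪ μ) {G : X → Y}
    {H : Y → X} (hG : Measurable G) (hH : Measurable H) (hHG : ∀ᵐ x ∂μ, H (G x) = x) :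
    ∀ᵐ x ∂μ, (ν.map G).rnDeriv (μ.map G) (G x) = ν.rnDeriv μ x := by
  have hm : Measurable fun y => ν.rnDeriv μ (H y) := (Measure.measurable_rnDeriv ν μ).comp hH
  have hmap : ν.map G = (μ.map G).withDensity fun y => ν.rnDeriv μ (H y) := by
    ext s hs
    rw [Measure.map_apply hG hs, withDensity_apply _ hs, setLIntegral_map hs hm hG,
      ← Measure.setLIntegral_rnDeriv hν]
    refine lintegral_congr_ae (ae_restrict_of_ae ?_)
    filter_upwards [hHG] with x hx
    rw [hx]
  have h := ae_of_ae_map hG.aemeasurable (Measure.rnDeriv_withDensity (μ.map G) hm)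
  rw [← hmap] at h
  filter_upwards [h, hHG] with x hx hx'
  rw [hx, hx']

/-- A property which holds `ν`-almost everywhere holds `μ`-almost everywhere on the set where the
density of `ν` does not vanish. -/
lemma ae_of_rnDeriv_ne_zero {X : Type*} [MeasurableSpace X] {μ ν : Measure X}
    [SigmaFinite μ] [SigmaFinite ν] (hν : ν ≪ μ) {p : X → Prop} (h : ∀ᵐ x ∂ν, p x) :
    ∀ᵐ x ∂μ, ν.rnDeriv μ x ≠ 0 → p x := by
  rw [← Measure.withDensity_rnDeriv_eq ν μ hν] at h
  exact (ae_withDensity_iff (Measure.measurable_rnDeriv ν μ)).1 h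

lemma lintegral_fin_prod {n : ℕ} {μ : Fin n → Measure ℝ} [∀ i, SigmaFinite (μ i)]
    {f : Fin n → ℝ → ℝ≥0∞} (hf : ∀ i, Measurable (f i)) :
    ∫⁻ x, ∏ i, f i (x i) ∂Measure.pi μ = ∏ i, ∫⁻ t, f i t ∂μ i := by
  induction n with
  | zero => simp
  | succ n ih =>
    have hm : Measurable fun x : Fin n → ℝ => ∏ i, f i.succ (x i) :=
      Finset.measurable_prod _ fun i _ => (hf _).comp (measurable_pi_apply i)
    rw [Fin.prod_univ_succ, ← ih fun i => hf _,
      ← lintegral_prod_mul (hf 0).aemeasurable hm.aemeasurable,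
      ← ((measurePreserving_piFinSuccAbove μ 0).symm).lintegral_comp_emb
        (MeasurableEquiv.measurableEmbedding _)]
    simp_rw [MeasurableEquiv.piFinSuccAbove_symm_apply, Fin.insertNthEquiv,
      Fin.prod_univ_succ, Fin.insertNth_zero, Equiv.coe_fn_mk, Fin.cons_succ,
      Fin.zero_succAbove, cast_eq, Fin.cons_zero]

section Pi

variable {ι : Type*} [Fintype ι]

lemma lintegral_pi_prod {μ : ι → Measure ℝ} [∀ i, SigmaFinite (μ i)]
    {f : ι → ℝ → ℝ≥0∞} (hf : ∀ i, Measurable (f i)) :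
    ∫⁻ x, ∏ i, f i (x i) ∂Measure.pi μ = ∏ i, ∫⁻ t, f i t ∂μ i := by
  let e := (Fintype.equivFin ι).symm
  rw [← (measurePreserving_piCongrLeft μ e).lintegral_comp_emb
    (MeasurableEquiv.measurableEmbedding _)]
  simp_rw [← e.prod_comp, MeasurableEquiv.coe_piCongrLeft, Equiv.piCongrLeft_apply_apply]
  exact lintegral_fin_prod fun i => hf _

lemma pi_withDensity {μ : ι → Measure ℝ} [∀ i, SigmaFinite (μ i)]
    {f : ι → ℝ → ℝ≥0∞} (hf : ∀ i, Measurable (f i))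
    [∀ i, SigmaFinite ((μ i).withDensity (f i))] :
    Measure.pi (fun i => (μ i).withDensity (f i)) =
      (Measure.pi μ).withDensity fun x => ∏ i, f i (x i) := by
  refine Measure.pi_eq fun s hs => ?_
  have h : ∀ x : ι → ℝ, (Set.univ.pi s).indicator (fun x => ∏ i, f i (x i)) x =
      ∏ i, (s i).indicator (f i) (x i) := by
    intro x
    by_cases hx : x ∈ Set.univ.pi s
    · rw [Set.indicator_of_mem hx]
      exact Finset.prod_congr rfl fun i _ => (Set.indicator_of_mem (hx i trivial) _).symm
    · rw [Set.indicator_of_notMem hx]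
      simp only [Set.mem_pi, Set.mem_univ, true_imp_iff, not_forall] at hx
      obtain ⟨i, hi⟩ := hx
      exact (Finset.prod_eq_zero (Finset.mem_univ i) (Set.indicator_of_notMem hi _)).symm
  rw [withDensity_apply _ (MeasurableSet.univ_pi hs),
    ← lintegral_indicator (MeasurableSet.univ_pi hs), lintegral_congr h,
    lintegral_pi_prod fun i => (hf i).indicator (hs i)]
  refine Finset.prod_congr rfl fun i _ => ?_
  rw [lintegral_indicator (hs i), withDensity_apply _ (hs i)]

/-- A distribution with a density is absolutely continuous with respect to the product of its
marginals. -/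
lemma absolutelyContinuous_pi_marginals {ν : ι → Measure ℝ} [∀ i, SigmaFinite (ν i)]
    {Q : Measure (ι → ℝ)} [IsProbabilityMeasure Q] (hQ : Q ≪ Measure.pi ν) :
    (∀ i, Q.map (fun x => x i) ≪ ν i) ∧
    (Measure.pi fun i => Q.map fun x => x i) = (Measure.pi ν).withDensity
      (fun x => ∏ i, (Q.map fun x => x i).rnDeriv (ν i) (x i)) ∧
    Q ≪ Measure.pi fun i => Q.map fun x => x i := by
  have hprob : ∀ i, IsProbabilityMeasure (Q.map fun x => x i) := fun i =>
    Measure.isProbabilityMeasure_map (measurable_pi_apply i).aemeasurable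
  have hac : ∀ i, Q.map (fun x => x i) ≪ ν i := fun i =>
    (hQ.map (measurable_pi_apply i)).trans (Measure.quasiMeasurePreserving_eval ν i).2
  have hf : ∀ i, Measurable ((Q.map fun x => x i).rnDeriv (ν i)) := fun i =>
    Measure.measurable_rnDeriv _ _
  have hd : ∀ i, (ν i).withDensity ((Q.map fun x => x i).rnDeriv (ν i)) = Q.map fun x => x i :=
    fun i => Measure.withDensity_rnDeriv_eq _ _ (hac i)
  have hsf : ∀ i, SigmaFinite ((ν i).withDensity ((Q.map fun x => x i).rnDeriv (ν i))) :=
    fun i => by rw [hd]; infer_instance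
  have heq := pi_withDensity (μ := ν) hf
  simp_rw [hd] at heq
  refine ⟨hac, heq, ?_⟩
  have hprod : Measurable fun x : ι → ℝ => ∏ i, (Q.map fun x => x i).rnDeriv (ν i) (x i) :=
    Finset.measurable_prod _ fun i _ => (hf i).comp (measurable_pi_apply i)
  -- the marginal densities do not vanish `Q`-almost everywhere
  have hne : ∀ᵐ x ∂Q, ∏ i, (Q.map fun x => x i).rnDeriv (ν i) (x i) ≠ 0 := by
    have : ∀ᵐ x ∂Q, ∀ i, 0 < (Q.map fun x => x i).rnDeriv (ν i) (x i) :=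
      ae_all_iff.2 fun i => ae_of_ae_map (measurable_pi_apply i).aemeasurable
        (Measure.rnDeriv_pos (hac i))
    filter_upwards [this] with x hx
    exact Finset.prod_ne_zero_iff.2 fun i _ => (hx i).ne'
  rw [heq]
  refine Measure.AbsolutelyContinuous.mk fun s _ hs0 => ?_
  rw [withDensity_apply_eq_zero hprod] at hs0
  refine measure_mono_null (fun x hx => ?_) (measure_union_null (hQ hs0) hne)
  by_cases h : ∏ i, (Q.map fun x => x i).rnDeriv (ν i) (x i) = 0
  · exact Or.inr fun h' => h' h
  · exact Or.inl ⟨h, hx⟩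

end Pi

/-! ### The probability integral transform -/

section Cdf

/-- The quantile function, as a supremum over rational points: a measurable left inverse of the
distribution function up to a null set. -/
noncomputable def cdfInv (ρ : Measure ℝ) (u : ℝ) : ℝ :=
  (⨆ q : ℚ, if cdf ρ q < u then ((q : ℝ) : EReal) else ⊥).toReal

lemma measurable_cdfInv {ρ : Measure ℝ} : Measurable (cdfInv ρ) := by
  refine Measurable.comp measurable_ereal_toReal (Measurable.iSup fun q => ?_)
  exact Measurable.ite measurableSet_Ioi measurable_const measurable_const

variable {ρ : Measure ℝ} [IsProbabilityMeasure ρ]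

lemma continuous_cdf_of_singleton (hρ : ∀ x, ρ {x} = 0) : Continuous (cdf ρ) := by
  refine continuous_iff_continuousAt.2 fun x => continuousAt_iff_continuous_left'_right'.2
    ⟨?_, ((cdf ρ).right_continuous x).mono Set.Ioi_subset_Ici_self⟩
  rw [(cdf ρ).mono.continuousWithinAt_Iio_iff_leftLim_eq]
  have h := hρ x
  rw [← measure_cdf ρ, StieltjesFunction.measure_singleton, ENNReal.ofReal_eq_zero] at h
  exact le_antisymm ((cdf ρ).mono.leftLim_le le_rfl) (by linarith)

lemma exists_cdf_eq (hρ : ∀ x, ρ {x} = 0) {t : ℝ} (h0 : 0 < t) (h1 : t < 1) :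
    ∃ x, cdf ρ x = t :=
  mem_range_of_exists_le_of_exists_ge (continuous_cdf_of_singleton hρ)
    (((tendsto_cdf_atBot ρ).eventually (gt_mem_nhds h0)).exists.imp fun _ h => h.le)
    (((tendsto_cdf_atTop ρ).eventually (lt_mem_nhds h1)).exists.imp fun _ h => h.le)

lemma measure_cdf_le (hρ : ∀ x, ρ {x} = 0) {t : ℝ} (h0 : 0 ≤ t) (h1 : t < 1) :
    ρ {x | cdf ρ x ≤ t} = ENNReal.ofReal t := by
  refine le_antisymm ?_ ?_
  · have hlt : ∀ t', t < t' → t' < 1 → ρ {x | cdf ρ x ≤ t} ≤ ENNReal.ofReal t' := by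
      intro t' ht ht'
      obtain ⟨y, hy⟩ := exists_cdf_eq hρ (h0.trans_lt ht) ht'
      rw [← hy, ofReal_cdf]
      refine measure_mono fun x (hx : cdf ρ x ≤ t) => ?_
      by_contra hxy
      have := (cdf ρ).mono (le_of_not_ge hxy)
      linarith
    have hlim : Filter.Tendsto ENNReal.ofReal (nhdsWithin t (Set.Ioi t)) (nhds (.ofReal t)) :=
      (ENNReal.continuous_ofReal.tendsto t).mono_left nhdsWithin_le_nhds
    refine ge_of_tendsto hlim ?_
    filter_upwards [Ioo_mem_nhdsGT h1] with t' ht' using hlt t' ht'.1 ht'.2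
  · rcases h0.eq_or_lt with rfl | h0
    · simp
    · obtain ⟨y, hy⟩ := exists_cdf_eq hρ h0 h1
      rw [← hy, ofReal_cdf]
      exact measure_mono fun x hx => (cdf ρ).mono hx

/-- The probability integral transform: for a continuous distribution, `F(X)` is uniform. -/
lemma map_cdf_eq (hρ : ∀ x, ρ {x} = 0) : ρ.map (cdf ρ) = volume.restrict (Set.Icc 0 1) := by
  have hm : Measurable (cdf ρ) := (cdf ρ).mono.measurable
  refine Measure.ext_of_Iic _ _ fun t => ?_
  rw [Measure.map_apply hm measurableSet_Iic, Measure.restrict_apply measurableSet_Iic,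
    Set.inter_comm]
  have hI : Set.Icc (0 : ℝ) 1 ∩ Set.Iic t = Set.Icc 0 (min 1 t) := by
    ext x; simp [and_assoc]
  rw [hI]
  rcases lt_or_ge t 0 with h0 | h0
  · have h : cdf ρ ⁻¹' Set.Iic t = ∅ :=
      Set.eq_empty_of_forall_notMem fun x (hx : cdf ρ x ≤ t) =>
        (hx.trans_lt h0).not_ge (cdf_nonneg ρ x)
    rw [h, Set.Icc_eq_empty fun h => (lt_of_le_of_lt (h.trans (min_le_right _ _)) h0).false]
    simp
  · rcases lt_or_ge t 1 with h1 | h1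
    · rw [min_eq_right h1.le, Real.volume_Icc, sub_zero, ← measure_cdf_le hρ h0 h1]
      rfl
    · have h : cdf ρ ⁻¹' Set.Iic t = Set.univ :=
        Set.eq_univ_of_forall fun x => (cdf_le_one ρ x).trans h1
      rw [h, min_eq_left h1]
      simp

lemma cdfInv_cdf (hρ : ∀ x, ρ {x} = 0) : ∀ᵐ x ∂ρ, cdfInv ρ (cdf ρ x) = x := by
  have hm : Measurable (cdf ρ) := (cdf ρ).mono.measurable
  have hnull : ∀ᵐ x ∂ρ, ∀ q : ℚ, cdf ρ x ≠ cdf ρ q := by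
    refine ae_all_iff.2 fun q => ?_
    have h : (ρ.map (cdf ρ)) {cdf ρ q} = 0 := by
      rw [map_cdf_eq hρ]
      exact le_antisymm ((Measure.restrict_apply_le _ _).trans (by simp)) zero_le
    rw [Measure.map_apply hm (measurableSet_singleton _)] at h
    exact measure_mono_null (fun x hx => not_not.1 hx) h
  filter_upwards [hnull] with x hx
  have hiff : ∀ q : ℚ, cdf ρ q < cdf ρ x ↔ (q : ℝ) < x := by
    intro q
    constructor
    · intro h
      by_contra hle
      exact h.not_ge ((cdf ρ).mono (not_lt.1 hle))
    · intro h
      exact lt_of_le_of_ne ((cdf ρ).mono h.le) (hx q).symm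
  have hsup : (⨆ q : ℚ, if cdf ρ q < cdf ρ x then ((q : ℝ) : EReal) else ⊥) = (x : EReal) := by
    refine le_antisymm (iSup_le fun q => ?_) (le_of_forall_lt fun b hb => ?_)
    · split_ifs with h
      · exact EReal.coe_le_coe_iff.2 ((hiff q).1 h).le
      · exact bot_le
    · obtain ⟨q, hq1, hq2⟩ := EReal.lt_iff_exists_rat_btwn.1 hb
      refine hq1.trans_le (le_iSup_of_le q ?_)
      rw [if_pos ((hiff q).2 (EReal.coe_lt_coe_iff.1 hq2))]
  rw [cdfInv, hsup, EReal.toReal_coe]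

end Cdf

/-! ### The density form of Sklar's theorem -/

section Sklar

lemma measurable_marginalCdf {ι : Type*} (Q : Measure (ι → ℝ)) :
    Measurable fun (x : ι → ℝ) i => marginalCdf Q i (x i) :=
  measurable_pi_lambda _ fun i =>
    (cdf (Q.map fun x => x i)).mono.measurable.comp (measurable_pi_apply i)

variable {ι : Type*} [Fintype ι]

lemma map_pi_marginalCdf {Q : Measure (ι → ℝ)} [IsProbabilityMeasure Q]
    (hQ : ∀ i x, Q.map (fun x => x i) {x} = 0) :
    (Measure.pi fun i => Q.map fun x => x i).map (fun x i => marginalCdf Q i (x i)) =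
      cubeVolume ι := by
  have hprob : ∀ i, IsProbabilityMeasure (Q.map fun x => x i) := fun i =>
    Measure.isProbabilityMeasure_map (measurable_pi_apply i).aemeasurable
  have hmap : ∀ i, (Q.map fun x => x i).map (marginalCdf Q i) = volume.restrict (Set.Icc 0 1) :=
    fun i => map_cdf_eq (hQ i)
  have hsf : ∀ i, SigmaFinite ((Q.map fun x => x i).map (marginalCdf Q i)) := fun i => by
    rw [hmap]; infer_instance
  have hm : ∀ i, Measurable (marginalCdf Q i) := fun i =>
    (cdf (Q.map fun x : ι → ℝ => x i)).mono.measurable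
  have h := Measure.pi_map_pi (μ := fun i => Q.map fun x => x i) (f := fun i => marginalCdf Q i)
    fun i => (hm i).aemeasurable
  rw [h]
  simp_rw [hmap]
  rw [cubeVolume, volume_pi, ← Measure.restrict_pi_pi, Set.pi_univ_Icc]
  rfl

/-- Sklar's theorem for densities, relative to a product measure `⊗ ν i`: the density of `Q` is the
copula density at `(F_i (x_i))_i` times the product of the marginal densities.  Any version `c` of
the copula density may be used. -/
theorem copulaDensity_mul_prod_rnDeriv {ν : ι → Measure ℝ} [∀ i, SigmaFinite (ν i)]
    (hν : ∀ i x, ν i {x} = 0) {Q : Measure (ι → ℝ)} [IsProbabilityMeasure Q]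
    (hQ : Q ≪ Measure.pi ν) {c : (ι → ℝ) → ℝ≥0∞} (hc : c =ᵐ[cubeVolume ι] copulaDensity Q) :
    ∀ᵐ x ∂Measure.pi ν, c (fun i => marginalCdf Q i (x i)) *
      ∏ i, (Q.map fun x => x i).rnDeriv (ν i) (x i) = Q.rnDeriv (Measure.pi ν) x := by
  have hprob : ∀ i, IsProbabilityMeasure (Q.map fun x => x i) := fun i =>
    Measure.isProbabilityMeasure_map (measurable_pi_apply i).aemeasurable
  obtain ⟨hac, hpi, hQpi⟩ := absolutelyContinuous_pi_marginals hQ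
  have hatom : ∀ i x, Q.map (fun x => x i) {x} = 0 := fun i x => hac i (hν i x)
  have hG := measurable_marginalCdf Q
  have hprod : Measurable fun x : ι → ℝ => ∏ i, (Q.map fun x => x i).rnDeriv (ν i) (x i) :=
    Finset.measurable_prod _ fun i _ =>
      (Measure.measurable_rnDeriv _ _).comp (measurable_pi_apply i)
  -- the transform is injective up to null sets, with the quantile functions as its inverse
  have hH : Measurable fun (u : ι → ℝ) i => cdfInv (Q.map fun x => x i) (u i) :=
    measurable_pi_lambda _ fun i => measurable_cdfInv.comp (measurable_pi_apply i)
  have hHG : ∀ᵐ x ∂Measure.pi fun i => Q.map fun x => x i,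
      (fun i => cdfInv (Q.map fun x => x i) (marginalCdf Q i (x i))) = x := by
    have : ∀ᵐ x ∂Measure.pi fun i => Q.map fun x => x i,
        ∀ i, cdfInv (Q.map fun x => x i) (marginalCdf Q i (x i)) = x i :=
      ae_all_iff.2 fun i => (Measure.quasiMeasurePreserving_eval (fun i => Q.map fun x => x i) i).ae
        (cdfInv_cdf (hatom i))
    filter_upwards [this] with x hx using funext hx
  have h1 := rnDeriv_map_comp_of_leftInverse hQpi hG hH hHG
  have h2 : ∀ᵐ x ∂Measure.pi fun i => Q.map fun x => x i,
      c (fun i => marginalCdf Q i (x i)) = copulaDensity Q fun i => marginalCdf Q i (x i) := by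
    rw [← map_pi_marginalCdf hatom] at hc
    exact ae_of_ae_map hG.aemeasurable hc
  have h3 : ∀ᵐ x ∂Measure.pi fun i => Q.map fun x => x i,
      c (fun i => marginalCdf Q i (x i)) =
        Q.rnDeriv (Measure.pi fun i => Q.map fun x => x i) x := by
    filter_upwards [h1, h2] with x hx1 hx2
    rw [hx2, ← hx1, copulaDensity, copula, ← map_pi_marginalCdf hatom]
  have h4 := Measure.rnDeriv_mul_rnDeriv (κ := Measure.pi ν) hQpi
  have h5 := Measure.rnDeriv_withDensity (Measure.pi ν) hprod
  rw [← hpi] at h5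
  have h6 : ∀ p : (ι → ℝ) → Prop, (∀ᵐ x ∂Measure.pi fun i => Q.map fun x => x i, p x) →
      ∀ᵐ x ∂Measure.pi ν, ∏ i, (Q.map fun x => x i).rnDeriv (ν i) (x i) ≠ 0 → p x := by
    intro p hp
    rw [hpi] at hp
    exact (ae_withDensity_iff hprod).1 hp
  have h7 := h6 _ h3
  filter_upwards [h4, h5, h7] with x hx4 hx5 hx6
  rw [← hx4, Pi.mul_apply, hx5]
  by_cases h0 : ∏ i, (Q.map fun x => x i).rnDeriv (ν i) (x i) = 0
  · rw [h0, mul_zero, mul_zero]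
  · rw [hx6 h0]

end Sklar

/-! ### Densities relative to the product of the marginals -/

section RelDensity

variable {Ω E F : Type*} [MeasurableSpace Ω] [MeasurableSpace E] [MeasurableSpace F]

/-- The density of the law of `X` under `P` with respect to its law under `μ`, at `X ω`. -/
noncomputable def relDensity (P μ : Measure Ω) (X : Ω → E) (ω : Ω) : ℝ≥0∞ :=
  (P.map X).rnDeriv (μ.map X) (X ω)

variable {P μ : Measure Ω} [IsProbabilityMeasure P] [IsProbabilityMeasure μ]

lemma relDensity_comp (hP : P ≪ μ) {X : Ω → E} (hX : Measurable X) {G : E → F} {H : F → E}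
    (hG : Measurable G) (hH : Measurable H) (hHG : ∀ x, H (G x) = x) :
    ∀ᵐ ω ∂μ, relDensity P μ (fun ω => G (X ω)) ω = relDensity P μ X ω := by
  have : IsProbabilityMeasure (P.map X) := Measure.isProbabilityMeasure_map hX.aemeasurable
  have : IsProbabilityMeasure (μ.map X) := Measure.isProbabilityMeasure_map hX.aemeasurable
  have h := ae_of_ae_map hX.aemeasurable
    (rnDeriv_map_comp_of_leftInverse (hP.map hX) hG hH (.of_forall hHG))
  rw [Measure.map_map hG hX, Measure.map_map hG hX] at h
  exact h

lemma relDensity_ne_top {X : Ω → E} (hX : Measurable X) :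
    ∀ᵐ ω ∂μ, relDensity P μ X ω ≠ ∞ := by
  have : IsProbabilityMeasure (P.map X) := Measure.isProbabilityMeasure_map hX.aemeasurable
  have : IsProbabilityMeasure (μ.map X) := Measure.isProbabilityMeasure_map hX.aemeasurable
  exact ae_of_ae_map hX.aemeasurable (Measure.rnDeriv_ne_top _ _)

/-- The zeros of the density of a function of `X` are zeros of the density of `X`. -/
lemma relDensity_eq_zero_of_comp (hP : P ≪ μ) {X : Ω → E} (hX : Measurable X) {G : E → F}
    (hG : Measurable G) :
    ∀ᵐ ω ∂μ, relDensity P μ (fun ω => G (X ω)) ω = 0 → relDensity P μ X ω = 0 := by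
  have hGX := hG.comp hX
  have : IsProbabilityMeasure (P.map X) := Measure.isProbabilityMeasure_map hX.aemeasurable
  have : IsProbabilityMeasure (μ.map X) := Measure.isProbabilityMeasure_map hX.aemeasurable
  have : IsProbabilityMeasure (P.map (G ∘ X)) :=
    Measure.isProbabilityMeasure_map hGX.aemeasurable
  have : IsProbabilityMeasure (μ.map (G ∘ X)) :=
    Measure.isProbabilityMeasure_map hGX.aemeasurable
  have h := Measure.rnDeriv_pos (hP.map hGX)
  rw [← Measure.map_map hG hX] at h
  have h' := ae_of_rnDeriv_ne_zero (hP.map hX) (ae_of_ae_map hG.aemeasurable h)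
  filter_upwards [ae_of_ae_map hX.aemeasurable h'] with ω hω h0
  by_contra hne
  have := hω hne
  rw [Measure.map_map hG hX] at this
  exact this.ne' h0

/-- The chain rule: if `X` and `Y` are independent under `μ`, the density of `(X, Y)` is the product
of the density of `X` and the conditional density of `Y` given `X`. -/
lemma rnDeriv_prodMk_eq_mul [StandardBorelSpace F] [Nonempty F]
    (hP : P ≪ μ) {X : Ω → E} {Y : Ω → F} (hX : Measurable X)
    (hY : Measurable Y) (hXY : IndepFun X Y μ) :
    (∀ᵐ s ∂P.map X, condDistrib Y X P s ≪ μ.map Y) ∧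
    ∀ᵐ ω ∂μ, relDensity P μ (fun ω => (X ω, Y ω)) ω = relDensity P μ X ω *
      Kernel.rnDeriv (condDistrib Y X P) (Kernel.const E (μ.map Y)) (X ω) (Y ω) := by
  have : IsProbabilityMeasure (P.map X) := Measure.isProbabilityMeasure_map hX.aemeasurable
  have : IsProbabilityMeasure (μ.map X) := Measure.isProbabilityMeasure_map hX.aemeasurable
  have : IsProbabilityMeasure (μ.map Y) := Measure.isProbabilityMeasure_map hY.aemeasurable
  have hμ : μ.map (fun ω => (X ω, Y ω)) = μ.map X ⊗ₘ Kernel.const E (μ.map Y) := by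
    rw [Measure.compProd_const]
    exact (indepFun_iff_map_prod_eq_prod_map_map hX.aemeasurable hY.aemeasurable).1 hXY
  have hPXY : P.map (fun ω => (X ω, Y ω)) = P.map X ⊗ₘ condDistrib Y X P :=
    (compProd_map_condDistrib hY.aemeasurable).symm
  have hac : ∀ᵐ s ∂P.map X, condDistrib Y X P s ≪ μ.map Y := by
    have h := hP.map (hX.prodMk hY)
    rw [hμ, hPXY] at h
    exact h.kernel_of_compProd
  refine ⟨hac, ?_⟩
  have hm := Kernel.measurable_rnDeriv (condDistrib Y X P) (Kernel.const E (μ.map Y))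
  have hm1 : Measurable fun p : E × F => (P.map X).rnDeriv (μ.map X) p.1 :=
    (Measure.measurable_rnDeriv _ _).comp measurable_fst
  have hdens : P.map (fun ω => (X ω, Y ω)) = (μ.map fun ω => (X ω, Y ω)).withDensity
      fun p => (P.map X).rnDeriv (μ.map X) p.1 *
        Kernel.rnDeriv (condDistrib Y X P) (Kernel.const E (μ.map Y)) p.1 p.2 := by
    have h1 : P.map X ⊗ₘ condDistrib Y X P = P.map X ⊗ₘ (Kernel.const E (μ.map Y)).withDensity
        (Kernel.rnDeriv (condDistrib Y X P) (Kernel.const E (μ.map Y))) := by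
      refine Measure.compProd_congr ?_
      filter_upwards [hac] with s hs
      exact (Kernel.withDensity_rnDeriv_eq (η := Kernel.const E (μ.map Y)) hs).symm
    have h2 : P.map X ⊗ₘ Kernel.const E (μ.map Y) =
        (μ.map X ⊗ₘ Kernel.const E (μ.map Y)).withDensity
          fun p => (P.map X).rnDeriv (μ.map X) p.1 := by
      rw [Measure.compProd_const, Measure.compProd_const,
        ← prod_withDensity_left (Measure.measurable_rnDeriv _ _),
        Measure.withDensity_rnDeriv_eq _ _ (hP.map hX)]
    rw [hPXY, h1, Measure.compProd_withDensity hm, h2, hμ]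
    exact (withDensity_mul _ hm1 hm).symm
  have : SigmaFinite (μ.map fun ω => (X ω, Y ω)) := by rw [hμ]; infer_instance
  have h := Measure.rnDeriv_withDensity (μ.map fun ω => (X ω, Y ω)) (hm1.mul hm)
  have h' := ae_of_ae_map (hX.prodMk hY).aemeasurable h
  filter_upwards [h'] with ω hω
  rw [relDensity, hdens]
  exact hω

end RelDensity

/-! ### Distribution functions and copulas of the members of a kernel -/

/-- Joint measurability of the distribution functions of the members of a kernel. -/
lemma measurable_cdf_kernel {α : Type*} [MeasurableSpace α] (κ : Kernel α ℝ) [IsMarkovKernel κ] :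
    Measurable fun p : α × ℝ => cdf (κ p.1) p.2 := by
  have h : (fun p : α × ℝ => cdf (κ p.1) p.2) = fun p : α × ℝ =>
      (κ p.1 (Prod.mk p ⁻¹' {r : (α × ℝ) × ℝ | r.2 ≤ r.1.2})).toReal := by
    funext p
    rw [cdf_eq_real, measureReal_def]
    rfl
  rw [h]
  have hs : MeasurableSet {r : (α × ℝ) × ℝ | r.2 ≤ r.1.2} :=
    measurableSet_le measurable_snd (measurable_snd.comp measurable_fst)
  exact (Kernel.measurable_kernel_prodMk_left (κ := κ.comap Prod.fst measurable_fst)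
    hs).ennreal_toReal

instance {α ι : Type*} [MeasurableSpace α] (κ : Kernel α (ι → ℝ)) [IsMarkovKernel κ] :
    IsMarkovKernel (copulaKernel κ) := by
  refine ⟨fun a => ?_⟩
  show IsProbabilityMeasure (copula (κ a))
  exact Measure.isProbabilityMeasure_map (measurable_marginalCdf (κ a)).aemeasurable

/-! ### Copula densities of subvectors and of conditional distributions -/

section Subvectors

lemma map_restrict_map_eval {V : Type*} {P : Measure (V → ℝ)} (K : Finset V) (i : K) :
    (P.map (K.restrict (π := fun _ => ℝ))).map (fun x => x i) = P.map fun x => x i :=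
  Measure.map_map (measurable_pi_apply i) (Finset.measurable_restrict K)

lemma marginal_absolutelyContinuous {V : Type*} [Fintype V] {P : Measure (V → ℝ)}
    (hP : P ≪ volume) (i : V) :
    P.map (fun x => x i) ≪ volume :=
  (hP.map (measurable_pi_apply i)).trans
    (Measure.quasiMeasurePreserving_eval (fun _ : V => (volume : Measure ℝ)) i).2

lemma marginal_singleton {V : Type*} [Fintype V] {P : Measure (V → ℝ)}
    (hP : P ≪ volume) (i : V) (t : ℝ) : P.map (fun x => x i) {t} = 0 :=
  marginal_absolutelyContinuous hP i (measure_singleton t)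

lemma measurable_condDistribFun {V : Type*} {P : Measure (V → ℝ)} [IsProbabilityMeasure P]
    (i : V) (S : Finset V) :
    Measurable fun p : (S → ℝ) × ℝ => condDistribFun P i S p.1 p.2 :=
  measurable_cdf_kernel _

variable {V : Type*} [Fintype V] {P : Measure (V → ℝ)} [IsProbabilityMeasure P]

/-- The product of the marginals of `P`. -/
noncomputable abbrev marginalProduct (P : Measure (V → ℝ)) : Measure (V → ℝ) :=
  Measure.pi fun i => P.map fun y => y i

instance (i : V) : IsProbabilityMeasure (P.map fun y => y i) :=
  Measure.isProbabilityMeasure_map (measurable_pi_apply i).aemeasurable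

lemma iIndepFun_marginalProduct :
    iIndepFun (fun (i : V) (x : V → ℝ) => x i) (marginalProduct P) :=
  iIndepFun_pi (X := fun _ t => t) fun _ => aemeasurable_id

lemma map_eval_marginalProduct (i : V) :
    (marginalProduct P).map (fun x => x i) = P.map fun x => x i :=
  (measurePreserving_eval (fun i => P.map fun y => y i) i).map_eq

lemma map_restrict_marginalProduct (K : Finset V) :
    (marginalProduct P).map (K.restrict (π := fun _ => ℝ)) =
      Measure.pi fun i : K => P.map fun x => x i := by
  have h := (iIndepFun_marginalProduct (P := P)).precomp
    (Subtype.val_injective : Function.Injective (Subtype.val : K → V))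
  have h' := (iIndepFun_iff_map_fun_eq_pi_map (μ := marginalProduct P)
    (f := fun (i : K) (x : V → ℝ) => x i)
    fun i => (measurable_pi_apply (i : V)).aemeasurable).1 h
  simp only [map_eval_marginalProduct] at h'
  exact h'

lemma absolutelyContinuous_marginalProduct (hP : P ≪ volume) : P ≪ marginalProduct P :=
  (absolutelyContinuous_pi_marginals (ν := fun _ => volume) hP).2.2

lemma marginalProduct_absolutelyContinuous (hP : P ≪ volume) : marginalProduct P ≪ volume := by
  rw [marginalProduct, (absolutelyContinuous_pi_marginals (ν := fun _ => volume) hP).2.1]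
  exact withDensity_absolutelyContinuous _ _

/-- The density of `X_K` with respect to the product of its marginals. -/
noncomputable abbrev clusterDensity (P : Measure (V → ℝ)) (K : Finset V) : (V → ℝ) → ℝ≥0∞ :=
  relDensity P (marginalProduct P) (K.restrict (π := fun _ => ℝ))

/-- At `u_i = F_i(x_i)` the copula density is the density with respect to the product of the
marginals. -/
lemma clusterCopula_ae_eq (hP : P ≪ volume) (K : Finset V) :
    ∀ᵐ x ∂marginalProduct P, clusterCopula P K x = clusterDensity P K x := by
  have hm : Measurable (K.restrict (π := fun _ => ℝ)) := Finset.measurable_restrict K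
  have : IsProbabilityMeasure (P.map (K.restrict (π := fun _ => ℝ))) :=
    Measure.isProbabilityMeasure_map hm.aemeasurable
  have hac := (absolutelyContinuous_marginalProduct hP).map hm
  rw [map_restrict_marginalProduct] at hac
  have h := copulaDensity_mul_prod_rnDeriv (ν := fun i : K => P.map fun x => x i)
    (fun i t => marginal_singleton hP i t) hac (c := copulaDensity _) (ae_eq_refl _)
  have h1 : ∀ᵐ x ∂Measure.pi fun i : K => P.map fun x => x i, ∀ i : K,
      ((P.map (K.restrict (π := fun _ => ℝ))).map fun x => x i).rnDeriv
        (P.map fun x => x i) (x i) = 1 := by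
    refine ae_all_iff.2 fun i => ?_
    rw [map_restrict_map_eval]
    exact (Measure.quasiMeasurePreserving_eval (fun i : K => P.map fun x => x i) i).ae
      (Measure.rnDeriv_self _)
  rw [← map_restrict_marginalProduct] at h h1
  filter_upwards [ae_of_ae_map hm.aemeasurable h, ae_of_ae_map hm.aemeasurable h1] with x hx hx1
  rw [Finset.prod_congr rfl fun i _ => hx1 i, Finset.prod_const_one, mul_one] at hx
  rw [clusterCopula, clusterDensity, relDensity, ← hx]
  simp only [marginalCdf, map_restrict_map_eval]
  rfl

lemma clusterDensity_ne_top (K : Finset V) :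
    ∀ᵐ x ∂marginalProduct P, clusterDensity P K x ≠ ∞ :=
  relDensity_ne_top (Finset.measurable_restrict K)

lemma clusterDensity_eq_zero_of_subset (hP : P ≪ volume) {S K : Finset V} (h : S ⊆ K) :
    ∀ᵐ x ∂marginalProduct P, clusterDensity P S x = 0 → clusterDensity P K x = 0 :=
  relDensity_eq_zero_of_comp (absolutelyContinuous_marginalProduct hP)
    (Finset.measurable_restrict K) (G := Finset.restrict₂ (π := fun _ => ℝ) h)
    (Finset.measurable_restrict₂ h)

lemma clusterDensity_singleton (hP : P ≪ volume) (i : V) :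
    ∀ᵐ x ∂marginalProduct P, clusterDensity P {i} x = 1 := by
  have h := relDensity_comp (absolutelyContinuous_marginalProduct hP)
    (Finset.measurable_restrict ({i} : Finset V))
    (G := fun y : ({i} : Finset V) → ℝ => y ⟨i, Finset.mem_singleton_self i⟩)
    (H := fun t _ => t) (measurable_pi_apply _) (measurable_pi_lambda _ fun _ => measurable_id)
    (fun y => funext fun j => by
      congr 1; exact Subtype.ext (Finset.mem_singleton.1 j.2).symm)
  have h' : ∀ᵐ x ∂marginalProduct P,
      (P.map fun x => x i).rnDeriv (P.map fun x => x i) (x i) = 1 :=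
    (Measure.quasiMeasurePreserving_eval (fun i : V => P.map fun x => x i) i).ae
      (Measure.rnDeriv_self _)
  filter_upwards [h, h'] with x hx hx'
  rw [clusterDensity, ← hx, relDensity]
  simp only [Finset.restrict]
  rw [map_eval_marginalProduct, hx']

/-- The density of the conditional distribution of `X_D` given `X_S`, with respect to the product of
the marginals. -/
noncomputable def condDensity (P : Measure (V → ℝ)) [IsProbabilityMeasure P] (D S : Finset V)
    (s : S → ℝ) (y : D → ℝ) : ℝ≥0∞ :=
  Kernel.rnDeriv (condDistrib (D.restrict (π := fun _ => ℝ)) S.restrict P)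
    (Kernel.const _ ((marginalProduct P).map (D.restrict (π := fun _ => ℝ)))) s y

/-- The density of the conditional distribution of `X_i` given `X_S`, with respect to the law of
`X_i`. -/
noncomputable def condDensitySingle (P : Measure (V → ℝ)) [IsProbabilityMeasure P] (i : V)
    (S : Finset V) (s : S → ℝ) (t : ℝ) : ℝ≥0∞ :=
  Kernel.rnDeriv (condDistrib (fun x : V → ℝ => x i) S.restrict P)
    (Kernel.const _ ((marginalProduct P).map fun x => x i)) s t

lemma indepFun_restrict {D S : Finset V} (h : Disjoint S D) :
    IndepFun (S.restrict (π := fun _ => ℝ)) (D.restrict (π := fun _ => ℝ)) (marginalProduct P) :=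
  iIndepFun_marginalProduct.indepFun_finset S D h fun i => measurable_pi_apply i

lemma indepFun_restrict_eval {S : Finset V} {i : V} (h : i ∉ S) :
    IndepFun (S.restrict (π := fun _ => ℝ)) (fun x : V → ℝ => x i) (marginalProduct P) :=
  (indepFun_restrict (Finset.disjoint_singleton_right.2 h)).comp (φ := id) measurable_id
    (measurable_pi_apply (⟨i, Finset.mem_singleton_self i⟩ : ({i} : Finset V)))

/-- Sklar's theorem for the conditional distributions of `X_D` given `X_S = s`. -/
lemma condCopulaDensity_mul_prod (hP : P ≪ volume) {D S : Finset V} (hSD : Disjoint S D) :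
    ∀ᵐ s ∂P.map (S.restrict (π := fun _ => ℝ)),
      ∀ᵐ y ∂(marginalProduct P).map (D.restrict (π := fun _ => ℝ)),
        condCopulaDensity P D S s (fun i => condDistribFun P i S s (y i)) *
          ∏ i : D, condDensitySingle P i S s (y i) = condDensity P D S s y := by
  have hac := (rnDeriv_prodMk_eq_mul (absolutelyContinuous_marginalProduct hP)
    (Finset.measurable_restrict S) (Finset.measurable_restrict D) (indepFun_restrict hSD)).1
  -- the marginals of the conditional distribution of `X_D` are those of its coordinates
  have hmarg : ∀ᵐ s ∂P.map (S.restrict (π := fun _ => ℝ)), ∀ i : D,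
      (condDistrib (D.restrict (π := fun _ => ℝ)) S.restrict P s).map (fun y => y i) =
        condDistrib (fun x : V → ℝ => x i) S.restrict P s := by
    refine ae_all_iff.2 fun i => ?_
    have h := condDistrib_comp (mβ := MeasurableSpace.pi) (μ := P) (S.restrict (π := fun _ => ℝ))
      (Finset.measurable_restrict D).aemeasurable (f := fun y : D → ℝ => y i)
      (measurable_pi_apply i)
    filter_upwards [h] with s hs
    rw [Kernel.map_apply _ (measurable_pi_apply i)] at hs
    exact hs.symm
  filter_upwards [hac, hmarg] with s hs hm
  rw [map_restrict_marginalProduct] at hs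
  have hc : condCopulaDensity P D S s =ᵐ[cubeVolume D]
      copulaDensity (condDistrib (D.restrict (π := fun _ => ℝ)) S.restrict P s) :=
    Kernel.rnDeriv_eq_rnDeriv_measure
      (κ := copulaKernel (condDistrib (D.restrict (π := fun _ => ℝ)) S.restrict P))
      (η := Kernel.const _ (cubeVolume D)) (a := s)
  have h1 := copulaDensity_mul_prod_rnDeriv (ν := fun i : D => P.map fun x => x i)
    (fun i t => marginal_singleton hP i t) hs hc
  have h2 : condDensity P D S s =ᵐ[Measure.pi fun i : D => P.map fun x => x i]
      (condDistrib (D.restrict (π := fun _ => ℝ)) S.restrict P s).rnDeriv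
        (Measure.pi fun i : D => P.map fun x => x i) := by
    rw [← map_restrict_marginalProduct]
    exact Kernel.rnDeriv_eq_rnDeriv_measure
      (η := Kernel.const _ ((marginalProduct P).map (D.restrict (π := fun _ => ℝ)))) (a := s)
  have h3 : ∀ᵐ y ∂Measure.pi fun i : D => P.map fun x => x i, ∀ i : D,
      condDensitySingle P i S s (y i) =
        (condDistrib (fun x : V → ℝ => x i) S.restrict P s).rnDeriv
          (P.map fun x => x i) (y i) := by
    refine ae_all_iff.2 fun i => ?_
    have : condDensitySingle P i S s =ᵐ[(marginalProduct P).map fun x => x i]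
        (condDistrib (fun x : V → ℝ => x i) S.restrict P s).rnDeriv
          ((marginalProduct P).map fun x => x i) := Kernel.rnDeriv_eq_rnDeriv_measure
      (κ := condDistrib (fun x : V → ℝ => x i) (S.restrict (π := fun _ => ℝ)) P)
      (η := Kernel.const _ ((marginalProduct P).map fun x : V → ℝ => x i)) (a := s)
    rw [map_eval_marginalProduct] at this
    exact (Measure.quasiMeasurePreserving_eval
      (fun i : D => P.map fun x : V → ℝ => x i) i).ae this
  rw [map_restrict_marginalProduct]
  filter_upwards [h1, h2, h3] with y hy1 hy2 hy3
  simp only [marginalCdf, hm] at hy1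
  rw [hy2, Finset.prod_congr rfl fun i _ => hy3 i, ← hy1]
  rfl

/-- The previous identity along the coordinates of `x`, where the density of `X_S` is not zero. -/
lemma condCopula_mul_prod (hP : P ≪ volume) {D S : Finset V} (hSD : Disjoint S D) :
    ∀ᵐ x ∂marginalProduct P, clusterDensity P S x ≠ 0 →
      condCopula P D S x * ∏ i : D, condDensitySingle P i S (S.restrict x) (x i) =
        condDensity P D S (S.restrict x) (D.restrict x) := by
  have hS : Measurable (S.restrict (π := fun _ => ℝ)) := Finset.measurable_restrict S
  have hD : Measurable (D.restrict (π := fun _ => ℝ)) := Finset.measurable_restrict D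
  have : IsProbabilityMeasure (P.map (S.restrict (π := fun _ => ℝ))) :=
    Measure.isProbabilityMeasure_map hS.aemeasurable
  have : IsProbabilityMeasure ((marginalProduct P).map (S.restrict (π := fun _ => ℝ))) :=
    Measure.isProbabilityMeasure_map hS.aemeasurable
  have : IsProbabilityMeasure ((marginalProduct P).map (D.restrict (π := fun _ => ℝ))) :=
    Measure.isProbabilityMeasure_map hD.aemeasurable
  have h := ae_of_rnDeriv_ne_zero ((absolutelyContinuous_marginalProduct hP).map hS)
    (condCopulaDensity_mul_prod hP hSD)
  have hmc : Measurable fun p : (S → ℝ) × (D → ℝ) =>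
      condCopulaDensity P D S p.1 fun i => condDistribFun P i S p.1 (p.2 i) := by
    refine (Kernel.measurable_rnDeriv
      (copulaKernel (condDistrib (D.restrict (π := fun _ => ℝ)) S.restrict P))
      (Kernel.const _ (cubeVolume D))).comp (measurable_fst.prodMk (measurable_pi_lambda _
        fun i => (measurable_condDistribFun (P := P) (i : V) S).comp
          (measurable_fst.prodMk ((measurable_pi_apply i).comp measurable_snd))))
  have hm1 : Measurable fun p : (S → ℝ) × (D → ℝ) =>
      ∏ i : D, condDensitySingle P i S p.1 (p.2 i) :=
    Finset.measurable_prod _ fun i _ => (Kernel.measurable_rnDeriv _ _).comp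
      (measurable_fst.prodMk ((measurable_pi_apply i).comp measurable_snd))
  have hm2 : Measurable fun p : (S → ℝ) × (D → ℝ) => condDensity P D S p.1 p.2 :=
    Kernel.measurable_rnDeriv _ _
  have hm3 : Measurable fun p : (S → ℝ) × (D → ℝ) =>
      (P.map (S.restrict (π := fun _ => ℝ))).rnDeriv
        ((marginalProduct P).map (S.restrict (π := fun _ => ℝ))) p.1 :=
    (Measure.measurable_rnDeriv _ _).comp measurable_fst
  have hset : MeasurableSet {p : (S → ℝ) × (D → ℝ) |
      (P.map (S.restrict (π := fun _ => ℝ))).rnDeriv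
        ((marginalProduct P).map (S.restrict (π := fun _ => ℝ))) p.1 ≠ 0 →
      condCopulaDensity P D S p.1 (fun i => condDistribFun P i S p.1 (p.2 i)) *
        ∏ i : D, condDensitySingle P i S p.1 (p.2 i) = condDensity P D S p.1 p.2} := by
    have h1 := measurableSet_eq_fun hm3 (measurable_const (a := (0 : ℝ≥0∞)))
    have h2 := measurableSet_eq_fun (hmc.mul hm1) hm2
    convert h1.union h2 using 1
    ext p
    simp only [Set.mem_ofPred_eq, Set.mem_union, ne_eq, ← or_iff_not_imp_left]
    rfl
  have hprod : ∀ᵐ p ∂(marginalProduct P).map (fun x => (S.restrict x, D.restrict x)),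
      (P.map (S.restrict (π := fun _ => ℝ))).rnDeriv
        ((marginalProduct P).map (S.restrict (π := fun _ => ℝ))) p.1 ≠ 0 →
      condCopulaDensity P D S p.1 (fun i => condDistribFun P i S p.1 (p.2 i)) *
        ∏ i : D, condDensitySingle P i S p.1 (p.2 i) = condDensity P D S p.1 p.2 := by
    have := (indepFun_iff_map_prod_eq_prod_map_map hS.aemeasurable hD.aemeasurable).1
      (indepFun_restrict (P := P) hSD)
    rw [this, Measure.ae_prod_iff_ae_ae hset]
    filter_upwards [h] with s hs
    by_cases h0 : (P.map (S.restrict (π := fun _ => ℝ))).rnDeriv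
        ((marginalProduct P).map (S.restrict (π := fun _ => ℝ))) s = 0
    · exact .of_forall fun y hy => absurd h0 hy
    · filter_upwards [hs h0] with y hy _ using hy
  exact ae_of_ae_map (hS.prodMk hD).aemeasurable hprod

variable [DecidableEq V]

/-- The chain rule for `X_S` and `X_D`, as an identity along the coordinates of `x`. -/
lemma clusterDensity_union (hP : P ≪ volume) {D S : Finset V} (hSD : Disjoint S D) :
    ∀ᵐ x ∂marginalProduct P, clusterDensity P (S ∪ D) x =
      clusterDensity P S x * condDensity P D S (S.restrict x) (D.restrict x) := by
  have hac := absolutelyContinuous_marginalProduct hP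
  have hH : Measurable fun (p : (S → ℝ) × (D → ℝ)) (i : ↥(S ∪ D)) =>
      if h : (i : V) ∈ S then p.1 ⟨i, h⟩ else if h : (i : V) ∈ D then p.2 ⟨i, h⟩ else 0 := by
    refine measurable_pi_lambda _ fun i => ?_
    by_cases h : (i : V) ∈ S
    · simp only [h, dite_true]
      exact (measurable_pi_apply _).comp measurable_fst
    · have hD : (i : V) ∈ D := (Finset.mem_union.1 i.2).resolve_left h
      simp only [h, hD, dite_true, dite_false]
      exact (measurable_pi_apply _).comp measurable_snd
  have h1 := relDensity_comp hac (Finset.measurable_restrict (S ∪ D))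
    (G := fun y => (Finset.restrict₂ (π := fun _ => ℝ) Finset.subset_union_left y,
      Finset.restrict₂ (π := fun _ => ℝ) Finset.subset_union_right y))
    ((measurable_pi_lambda _ fun _ => measurable_pi_apply _).prodMk
      (measurable_pi_lambda _ fun _ => measurable_pi_apply _)) hH
    (fun y => by
      funext i
      by_cases h : (i : V) ∈ S
      · simp only [h, dite_true]; rfl
      · have hD : (i : V) ∈ D := (Finset.mem_union.1 i.2).resolve_left h
        simp only [h, hD, dite_true, dite_false]; rfl)
  have h2 := (rnDeriv_prodMk_eq_mul hac (Finset.measurable_restrict S)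
    (Finset.measurable_restrict D) (indepFun_restrict hSD)).2
  filter_upwards [h1, h2] with x hx1 hx2
  exact hx1.symm.trans hx2

lemma clusterDensity_insert (hP : P ≪ volume) {S : Finset V} {i : V} (hi : i ∉ S) :
    ∀ᵐ x ∂marginalProduct P, clusterDensity P (insert i S) x =
      clusterDensity P S x * condDensitySingle P i S (S.restrict x) (x i) := by
  have hac := absolutelyContinuous_marginalProduct hP
  have hH : Measurable fun (p : (S → ℝ) × ℝ) (j : ↥(insert i S)) =>
      if h : (j : V) ∈ S then p.1 ⟨j, h⟩ else p.2 := by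
    refine measurable_pi_lambda _ fun j => ?_
    by_cases h : (j : V) ∈ S
    · simp only [h, dite_true]
      exact (measurable_pi_apply _).comp measurable_fst
    · simp only [h, dite_false]
      exact measurable_snd
  have h1 := relDensity_comp hac (Finset.measurable_restrict (insert i S))
    (G := fun y => (Finset.restrict₂ (π := fun _ => ℝ) (Finset.subset_insert i S) y,
      y ⟨i, Finset.mem_insert_self i S⟩))
    ((measurable_pi_lambda _ fun _ => measurable_pi_apply _).prodMk (measurable_pi_apply _)) hH
    (fun y => by
      funext j
      by_cases h : (j : V) ∈ S
      · simp only [h, dite_true]; rfl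
      · simp only [h, dite_false]
        congr 1
        exact Subtype.ext ((Finset.mem_insert.1 j.2).resolve_right h).symm)
  have h2 := (rnDeriv_prodMk_eq_mul hac (Finset.measurable_restrict S)
    (measurable_pi_apply i) (indepFun_restrict_eval hi)).2
  filter_upwards [h1, h2] with x hx1 hx2
  exact hx1.symm.trans hx2

/-- The pair copula density of two sets `A` and `B` with `|A \ B| = |B \ A| = 1`, expressed by
densities of subvectors. -/
theorem condCopula_mul_clusterDensity (hP : P ≪ volume) {A B : Finset V}
    (hA : (A \ B).card = 1) (hB : (B \ A).card = 1) :
    ∀ᵐ x ∂marginalProduct P, clusterDensity P (A ∩ B) x ≠ 0 →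
      condCopula P (A ∆ B) (A ∩ B) x * (clusterDensity P A x * clusterDensity P B x) =
        clusterDensity P (A ∪ B) x * clusterDensity P (A ∩ B) x := by
  obtain ⟨a, ha⟩ := Finset.card_eq_one.1 hA
  obtain ⟨b, hb⟩ := Finset.card_eq_one.1 hB
  have haA : a ∈ A ∧ a ∉ B := Finset.mem_sdiff.1 (ha ▸ Finset.mem_singleton_self a)
  have hbB : b ∈ B ∧ b ∉ A := Finset.mem_sdiff.1 (hb ▸ Finset.mem_singleton_self b)
  have hab : a ≠ b := fun h => haA.2 (h ▸ hbB.1)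
  have hD : A ∆ B = {a, b} := by
    rw [symmDiff_def, ha, hb]; rfl
  have hAi : insert a (A ∩ B) = A := by
    rw [Finset.insert_eq, ← ha, Finset.sdiff_union_inter]
  have hBi : insert b (A ∩ B) = B := by
    rw [Finset.insert_eq, ← hb, Finset.inter_comm, Finset.sdiff_union_inter]
  have hdisj : Disjoint (A ∩ B) (A ∆ B) := by
    rw [hD, Finset.disjoint_insert_right, Finset.disjoint_singleton_right]
    exact ⟨fun h => haA.2 (Finset.mem_inter.1 h).2, fun h => hbB.2 (Finset.mem_inter.1 h).1⟩
  have hU : A ∩ B ∪ A ∆ B = A ∪ B := by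
    rw [hD]
    ext v
    have h1 := Finset.ext_iff.1 hAi v
    have h2 := Finset.ext_iff.1 hBi v
    simp only [Finset.mem_union, Finset.mem_inter, Finset.mem_insert, Finset.mem_singleton]
      at h1 h2 ⊢
    tauto
  have h1 := condCopula_mul_prod hP hdisj
  have h2 := clusterDensity_union hP hdisj
  have h3 := clusterDensity_insert hP (S := A ∩ B) (i := a)
    fun h => haA.2 (Finset.mem_inter.1 h).2
  have h4 := clusterDensity_insert hP (S := A ∩ B) (i := b)
    fun h => hbB.2 (Finset.mem_inter.1 h).1
  rw [hAi] at h3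
  rw [hBi] at h4
  rw [hU] at h2
  filter_upwards [h1, h2, h3, h4] with x hx1 hx2 hx3 hx4 hx0
  have hx1 := hx1 hx0
  rw [Finset.prod_coe_sort (A ∆ B)
    fun i => condDensitySingle P i (A ∩ B) ((A ∩ B).restrict x) (x i)] at hx1
  have hpair : ∏ i ∈ A ∆ B, condDensitySingle P i (A ∩ B) ((A ∩ B).restrict x) (x i) =
      condDensitySingle P a (A ∩ B) ((A ∩ B).restrict x) (x a) *
        condDensitySingle P b (A ∩ B) ((A ∩ B).restrict x) (x b) := by
    rw [hD, Finset.prod_pair hab]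
  rw [hpair] at hx1
  rw [hx2, hx3, hx4, ← hx1]
  ring

end Subvectors

/-! ### The `t`-cherry copula density as a product of pair copula densities -/

section Final

lemma tCherryCopula_eq {V : Type*} [Fintype V] [DecidableEq V] {P : Measure (V → ℝ)} {k : ℕ}
    {T : ClusterTree V} (h : T.IsTCherry k) (x : V → ℝ) :
    tCherryCopula P T x = (∏ K ∈ T.clusters, clusterCopula P K x) /
      ∏ e ∈ T.links, clusterCopula P (linkSep e) x := by
  rw [tCherryCopula, h.prod_separators fun S => clusterCopula P S x]

lemma card_sdiff_eq_one {V : Type*} [DecidableEq V] {k : ℕ} {T : ClusterTree V}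
    (h : T.IsTCherry k) {A B : Finset V} (hAB : T.linked.Adj A B) : (A \ B).card = 1 := by
  have h1 := h.card_eq (T.mem_of_linked A B hAB)
  have h2 := h.card_inter hAB
  have h3 := Finset.card_sdiff_add_card_inter A B
  omega

lemma firstTreeProduct_eq {V : Type*} [Fintype V] [DecidableEq V] {P : Measure (V → ℝ)}
    {T : ClusterTree V} (h : T.IsTCherry 2) (x : V → ℝ) :
    firstTreeProduct P T.firstTree x = ∏ K ∈ T.clusters, clusterCopula P K x := by
  classical
  rw [← h.prod_firstTree fun K => clusterCopula P K x, firstTreeProduct]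

variable {V : Type*} [Fintype V] [DecidableEq V] {P : Measure (V → ℝ)} [IsProbabilityMeasure P]

/-- Along a regular vine structure the `t`-cherry copula density is the product of the pair copula
densities on the lower trees. -/
theorem IsRVineStructure.tCherryCopula_eq_prod (hP : P ≪ volume) {k : ℕ} (hk : 2 ≤ k)
    {T : ℕ → ClusterTree V} (hT : IsRVineStructure (T 2).firstTree T k) :
    ∀ᵐ x ∂marginalProduct P, tCherryCopula P (T k) x =
      firstTreeProduct P (T 2).firstTree x *
        ∏ m ∈ Finset.Icc 2 (k - 1), ∏ e ∈ (T m).links, linkCopula P x e := by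
  have h1 := ae_all_iff.2 fun K => clusterCopula_ae_eq (P := P) hP K
  have h2 := ae_all_iff.2 fun K => clusterDensity_ne_top (P := P) K
  have h3 : ∀ᵐ x ∂marginalProduct P, ∀ S K : Finset V, S ⊆ K →
      clusterDensity P S x = 0 → clusterDensity P K x = 0 := by
    refine ae_all_iff.2 fun S => ae_all_iff.2 fun K => ?_
    by_cases h : S ⊆ K
    · filter_upwards [clusterDensity_eq_zero_of_subset hP h] with x hx _ using hx
    · exact .of_forall fun x h' => absurd h' h
  have h4 : ∀ᵐ x ∂marginalProduct P, ∀ A B : Finset V, (A \ B).card = 1 → (B \ A).card = 1 →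
      clusterDensity P (A ∩ B) x ≠ 0 →
      condCopula P (A ∆ B) (A ∩ B) x * (clusterDensity P A x * clusterDensity P B x) =
        clusterDensity P (A ∪ B) x * clusterDensity P (A ∩ B) x := by
    refine ae_all_iff.2 fun A => ae_all_iff.2 fun B => ?_
    by_cases h : (A \ B).card = 1 ∧ (B \ A).card = 1
    · filter_upwards [condCopula_mul_clusterDensity hP h.1 h.2] with x hx _ _ using hx
    · exact .of_forall fun x hA hB => absurd ⟨hA, hB⟩ h
  have h5 := ae_all_iff.2 fun i => clusterDensity_singleton (P := P) hP i
  filter_upwards [h1, h2, h3, h4, h5] with x hx1 hx2 hx3 hx4 hx5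
  simp only [← hx1] at hx2 hx3 hx4 hx5
  have main : ∀ q, 2 ≤ q → q ≤ k →
      (∏ K ∈ (T q).clusters, clusterCopula P K x) /
        (∏ e ∈ (T q).links, clusterCopula P (linkSep e) x) =
      firstTreeProduct P (T 2).firstTree x *
        ∏ m ∈ Finset.Icc 2 (q - 1), ∏ e ∈ (T m).links, linkCopula P x e := by
    intro q hq
    induction q, hq using Nat.le_induction with
    | base =>
      intro _
      have hc := hT.isTCherry 2 le_rfl hk
      -- the separators of the second tree are single vertices, of copula density one
      have hsep : ∏ e ∈ (T 2).links, clusterCopula P (linkSep e) x = 1 := by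
        refine Finset.prod_eq_one fun e he => ?_
        obtain ⟨i, hi⟩ := Finset.card_eq_one.1 (Nat.succ_injective (hc.card_linkSep he))
        rw [hi, hx5]
      rw [hsep, div_one, firstTreeProduct_eq hc]
      simp
    | succ q hq ih =>
      intro hqk
      have hc := hT.isTCherry q hq (by omega)
      rw [hc.prod_div_succ (hT.covers q hq (by omega)) (hT.isTCherry (q + 1) (by omega) hqk)
        (hT.covers (q + 1) (by omega) hqk) (hT.union q hq hqk) (fun K => clusterCopula P K x)
        (fun e => linkCopula P x e) hx2 hx3 ?_, ih (by omega), mul_assoc]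
      · have hI : Finset.Icc 2 (q + 1 - 1) = insert q (Finset.Icc 2 (q - 1)) := by
          ext m
          simp only [Finset.mem_Icc, Finset.mem_insert]
          omega
        rw [hI, Finset.prod_insert (by simp only [Finset.mem_Icc]; omega), mul_comm (∏ e ∈ _, _)]
      · intro A B hAB hA _
        exact hx4 A B (card_sdiff_eq_one hc hAB) (card_sdiff_eq_one hc hAB.symm)
          fun h0 => hA (hx3 _ _ Finset.inter_subset_left h0)
  rw [tCherryCopula_eq (hT.isTCherry k hk le_rfl)]
  exact main k hk le_rfl

lemma volume_restrict_quasiMeasurePreserving {V : Type*} [Fintype V] [DecidableEq V]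
    (K : Finset V) :
    Measure.QuasiMeasurePreserving (K.restrict (π := fun _ => ℝ)) volume volume := by
  have h : Measure.QuasiMeasurePreserving (K.restrict (π := fun _ => ℝ)) volume _ :=
    Measure.quasiMeasurePreserving_fst.comp
      (volume_preserving_piEquivPiSubtypeProd (fun _ : V => ℝ)
        fun i => i ∈ K).quasiMeasurePreserving
  -- the two instances `Fintype K` are equal, but not by definition
  convert h using 3

/-- Sklar's theorem for the subvectors: `c_K ∏ f_i = f_K`. -/
lemma clusterCopula_mul_prod (hP : P ≪ volume) (K : Finset V) :
    ∀ᵐ x ∂(volume : Measure (V → ℝ)), clusterCopula P K x *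
      ∏ i ∈ K, (P.map fun y => y i).rnDeriv volume (x i) = marginalDensity P K x := by
  have hm : Measurable (K.restrict (π := fun _ => ℝ)) := Finset.measurable_restrict K
  have : IsProbabilityMeasure (P.map (K.restrict (π := fun _ => ℝ))) :=
    Measure.isProbabilityMeasure_map hm.aemeasurable
  have hac : P.map (K.restrict (π := fun _ => ℝ)) ≪ volume :=
    (hP.map hm).trans (volume_restrict_quasiMeasurePreserving K).2
  have h := copulaDensity_mul_prod_rnDeriv (ν := fun _ : K => volume)
    (fun i t => measure_singleton t) hac (c := copulaDensity _) (ae_eq_refl _)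
  filter_upwards [(volume_restrict_quasiMeasurePreserving K).ae h] with x hx
  simp only [marginalCdf, map_restrict_map_eval] at hx
  rw [← Finset.prod_coe_sort K]
  exact hx

/-- The copula density of a `t`-cherry distribution is its `t`-cherry copula density. -/
theorem clusterCopula_univ_eq_tCherryCopula (hP : P ≪ volume) {k : ℕ} {T : ClusterTree V}
    (hT : T.IsTCherry k) (hcov : T.Covers) (h : IsTCherryDistribution P T) :
    ∀ᵐ x ∂marginalProduct P, clusterCopula P Finset.univ x = tCherryCopula P T x := by
  have hμ := marginalProduct_absolutelyContinuous hP
  have h1 := hμ.ae_le (ae_all_iff.2 fun K => clusterCopula_mul_prod (P := P) hP K)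
  have h2 : ∀ᵐ x ∂marginalProduct P, ∀ i, (P.map fun y => y i).rnDeriv volume (x i) ≠ 0 := by
    refine ae_all_iff.2 fun i => ?_
    have hi : ∀ᵐ t ∂P.map (fun y : V → ℝ => y i),
        (P.map fun y : V → ℝ => y i).rnDeriv volume t ≠ 0 :=
      (Measure.rnDeriv_pos (marginal_absolutelyContinuous hP i)).mono fun t ht => ht.ne'
    exact (Measure.quasiMeasurePreserving_eval (fun i => P.map fun y : V → ℝ => y i) i).ae hi
  have h3 : ∀ᵐ x ∂marginalProduct P, ∀ i, (P.map fun y => y i).rnDeriv volume (x i) ≠ ∞ := by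
    refine ae_all_iff.2 fun i => ?_
    have hi : ∀ᵐ t ∂P.map (fun y : V → ℝ => y i),
        (P.map fun y : V → ℝ => y i).rnDeriv volume t ≠ ∞ :=
      (marginal_absolutelyContinuous hP i).ae_le (Measure.rnDeriv_ne_top _ _)
    exact (Measure.quasiMeasurePreserving_eval (fun i => P.map fun y : V → ℝ => y i) i).ae hi
  filter_upwards [h1, h2, h3, hμ.ae_le h] with x hx1 hx2 hx3 hx
  have hne : ∀ K : Finset V, ∏ i ∈ K, (P.map fun y => y i).rnDeriv volume (x i) ≠ 0 := fun K =>
    Finset.prod_ne_zero_iff.2 fun i _ => hx2 i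
  have hnt : ∀ K : Finset V, ∏ i ∈ K, (P.map fun y => y i).rnDeriv volume (x i) ≠ ∞ := fun K =>
    ENNReal.prod_ne_top fun i _ => hx3 i
  have hsep : ∏ S ∈ T.separators, marginalDensity P S x ^ (T.nu S - 1) =
      ∏ e ∈ T.links, marginalDensity P (linkSep e) x := hT.prod_separators _
  rw [hsep] at hx
  simp only [← hx1, Finset.prod_mul_distrib] at hx
  -- the marginal densities cancel
  rw [hT.prod_vertices, hcov.sup_eq_univ, ← mul_assoc, mul_right_comm,
    ENNReal.mul_div_mul_right _ _ (Finset.prod_ne_zero_iff.2 fun e _ => hne _)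
      (ENNReal.prod_ne_top fun e _ => hnt _)] at hx
  rw [tCherryCopula_eq hT]
  rw [ENNReal.mul_div_right_comm] at hx
  exact (ENNReal.mul_left_inj (hne _) (hnt _)).1 hx

end Final

theorem mainTheorem1 {V : Type*} [Fintype V] [DecidableEq V]
    -- the input: a `k`-th order `t`-cherry junction tree `T k` on `V`
    (k : ℕ) (hk : 2 ≤ k) (T : ℕ → ClusterTree V)
    (hT : (T k).IsTCherry k) (hcov : (T k).Covers)
    -- the algorithm is applied recursively
    (hrun : ∀ m, 2 ≤ m → m < k → (T (m + 1)).AlgorithmStep (T m))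
    -- the separators of each tree to which it is applied form a `t`-cherry junction tree
    (hsep : ∀ m, 1 ≤ m → m < k → (T (m + 1)).SeparatorsFormTCherry m)
    -- the law of a continuous random vector
    (P : Measure (V → ℝ)) [IsProbabilityMeasure P] (hP : P ≪ volume) :
    -- the result is a regular vine structure up to level `k`
    k < Fintype.card V ∧ IsRVineStructure (T 2).firstTree T k ∧
    -- the `t`-cherry copula density is the product of the pair copula densities on `T₁, …, T (k-1)`,
    -- for almost every `u` in the unit cube, i.e. almost every `x` for the product of the marginals
    (∀ᵐ x ∂Measure.pi (fun i : V => P.map fun y => y i),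
      tCherryCopula P (T k) x =
        firstTreeProduct P (T 2).firstTree x *
          ∏ m ∈ Finset.Icc 2 (k - 1), ∏ e ∈ (T m).links, linkCopula P x e) ∧
    -- it is a regular vine copula density truncated at level `k`
    (∃ T' : ℕ → ClusterTree V, (∀ m ≤ k, T' m = T m) ∧
      IsRVineStructure (T 2).firstTree T' (Fintype.card V - 1) ∧
      ∀ᵐ x ∂Measure.pi (fun i : V => P.map fun y => y i),
        tCherryCopula P (T k) x = truncatedRVineCopula P (T 2).firstTree T' k x) ∧
    -- if `P` is itself the `t`-cherry distribution, this is the copula density of `P`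
    (IsTCherryDistribution P (T k) →
      ∀ᵐ x ∂Measure.pi (fun i : V => P.map fun y => y i),
        clusterCopula P Finset.univ x =
          firstTreeProduct P (T 2).firstTree x *
            ∏ m ∈ Finset.Icc 2 (k - 1), ∏ e ∈ (T m).links, linkCopula P x e) := by
  have hv := isRVineStructure_of_algorithm hk hT hcov hrun hsep
  have hlt : k < Fintype.card V := by
    have hs : (T k).SeparatorsFormTCherry (k - 1) := by
      simpa only [Nat.sub_add_cancel (by omega : 1 ≤ k)] using hsep (k - 1) (by omega) (by omega)
    have h2 := ClusterTree.two_le_card_clusters hT hs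
    have h3 := hT.card_univ hcov
    omega
  have hprod := hv.tCherryCopula_eq_prod hP hk
  refine ⟨hlt, hv, hprod, ?_, fun h => ?_⟩
  · obtain ⟨T', hT', hv'⟩ := hv.exists_complete hk hlt
    refine ⟨T', hT', hv', ?_⟩
    filter_upwards [hprod] with x hx
    rw [hx, truncatedRVineCopula]
    congr 1
    have heq : ∏ m ∈ Finset.Icc 2 (k - 1), ∏ e ∈ (T m).links, linkCopula P x e =
        ∏ m ∈ Finset.Icc 2 (k - 1), ∏ e ∈ (T' m).links, if m < k then linkCopula P x e else 1 := by
      refine Finset.prod_congr rfl fun m hm => ?_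
      rw [Finset.mem_Icc] at hm
      rw [hT' m (by omega)]
      exact Finset.prod_congr rfl fun e _ => (if_pos (by omega)).symm
    rw [heq]
    refine Finset.prod_subset (Finset.Icc_subset_Icc_right (by omega)) fun m hm hm' => ?_
    rw [Finset.mem_Icc] at hm hm'
    exact Finset.prod_eq_one fun e _ => if_neg (by omega)
  · filter_upwards [clusterCopula_univ_eq_tCherryCopula hP hT hcov h, hprod] with x hx1 hx2
    rw [hx1, hx2]
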